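/- Let $n\ge 1$ and let $Sp(2n,\mathbb Z)$ be the integral symplectic group, that is, the group of all $2n\times 2n$ integer matrices $M$ with $M J M^{T}=J$, where $J=\begin{pmatrix}0&-I_n\\ I_n&0\end{pmatrix}$. For an automorphism $\varphi$ of a group $G$, the Reidemeister number $R(\varphi)\in\{1,2,\dots\}\cup\{\infty\}$ is the number of equivalence classes of the relation on $G$ given by $x\sim g\,x\,\varphi(g^{-1})$ for $x,g\in G$. **Theorem 3.3.** For every automorphism $\varphi$ of $Sp(2n,\mathbb Z)$ one has $R(\varphi)=\infty$; in other words, $Sp(2n,\mathbb Z)$ has property $R_\infty$. -/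

import Mathlib

/-- Twisted conjugacy with respect to an automorphism `φ` of a group `G`: the equivalence relation
`x ∼ g * x * φ (g⁻¹)` for `g : G`. Its classes are the Reidemeister classes of `φ`. -/
def twistedConjSetoid {G : Type*} [Group G] (φ : MulAut G) : Setoid G where
  r x y := ∃ g : G, y = g * x * φ g⁻¹
  iseqv :=
    { refl := fun x => ⟨1, by simp⟩
      symm := by
        rintro x y ⟨g, rfl⟩
        exact ⟨g⁻¹, by simp [mul_assoc]⟩
      trans := by
        rintro x y z ⟨g, rfl⟩ ⟨h, rfl⟩
        exact ⟨h * g, by simp [mul_assoc]⟩ }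

/-- The Reidemeister number `R(φ)`: the number of Reidemeister classes of `φ`,
with value `⊤` exactly when there are infinitely many of them. -/
noncomputable def reidemeisterNumber {G : Type*} [Group G] (φ : MulAut G) : ℕ∞ :=
  ENat.card (Quotient (twistedConjSetoid φ))

/-! The heart of the matter is that every automorphism has the form `φ x = ± g x g⁻¹`, where `g` is
an integral similitude of the symplectic form with multiplier `d = ±1` and the sign depends on `x`.
If `y = z x φ(z⁻¹)`, then `y g = ± z (x g) z⁻¹`, so the trace of `(x g)²` is constant on
Reidemeister classes. As `x g` runs over all similitudes of multiplier `d`, this trace takes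
infinitely many values (`reidemeisterNumber_eq_top_of_mapsTransvections`).

To find `g`, it suffices that `φ` sends one nontrivial power of a transvection in a primitive vector
to another such power. Centralizers then force `φ (T 1 v) = ± T (±1) w`, and transitivity on
primitive vectors makes both signs uniform in `v`. Commutation and the braid relation detect
pairings `0` and `±1`, so the vectors `w`, with signs chosen coherently, are the images of the `v`
under a similitude (`exists_similitude`, `exists_conj`).

For `n ≥ 2`, the standard representation is twisted by `φ`. If `u` and `v` are orthogonal, the
eigenvalues of the transvection in `v + m u` on a common eigenvector are `a c^m b^(m²)`; all
transvections being conjugate, these form a finite set, so `b` is a root of unity and a common power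
of all transvections acts unipotently. The `2^n` diagonal sign matrices split the space into exactly
`n` planes. The unipotent images attached to one hyperbolic plane fail to commute on one of these
planes, and this forces the others to be trivial there; each thus has rank one after subtracting
`1`, hence is a power of a transvection (`exists_map_T_eq`).

For `n = 1`, let `s` and `u` be the images of the generators of orders four and six. Their traces
are `0` and `1`, and they generate an order containing every group element. Divisibility of
commutators by `θ² - 3`, with `θ = tr(s u)`, gives `θ = ±2`, so the square of a transvection has
unipotent image (`exists_map_T_eq_plane`). -/

open Matrix

namespace Symplectic

/-- The sign occurring in the pairing with a basis vector. -/
def sgn {l : Type*} : l ⊕ l → ℤ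
  | .inl _ => -1
  | .inr _ => 1

theorem sgn_mul_self {l : Type*} (p : l ⊕ l) : sgn p * sgn p = 1 := by cases p <;> simp [sgn]

theorem sgn_cases {l : Type*} (p : l ⊕ l) : sgn p = 1 ∨ sgn p = -1 := by cases p <;> simp [sgn]

/-! ### The alternating form and its transvections -/

section Form

variable {l R : Type*} [Fintype l] [DecidableEq l] [CommRing R]

/-- The standard alternating form, given by the matrix `J`. -/
def form (x y : l ⊕ l → R) : R := x ⬝ᵥ J l R *ᵥ y

theorem form_eq_sum (x y : l ⊕ l → R) :
    form x y = ∑ i, (x (.inr i) * y (.inl i) - x (.inl i) * y (.inr i)) := by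
  simp [form, J, dotProduct, fromBlocks_mulVec, Fintype.sum_sum_type, Finset.sum_sub_distrib,
    Matrix.neg_mulVec]
  ring

theorem form_add_left (x y z : l ⊕ l → R) : form (x + y) z = form x z + form y z := by
  simp [form, add_dotProduct]

theorem form_add_right (x y z : l ⊕ l → R) : form x (y + z) = form x y + form x z := by
  simp [form, mulVec_add, dotProduct_add]

theorem form_smul_left (c : R) (x y : l ⊕ l → R) : form (c • x) y = c * form x y := by
  simp [form]

theorem form_smul_right (c : R) (x y : l ⊕ l → R) : form x (c • y) = c * form x y := by
  simp [form, mulVec_smul]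

theorem form_neg_left (x y : l ⊕ l → R) : form (-x) y = -form x y := by simp [form]

theorem form_neg_right (x y : l ⊕ l → R) : form x (-y) = -form x y := by simp [form, mulVec_neg]

theorem form_sub_left (x y z : l ⊕ l → R) : form (x - y) z = form x z - form y z := by
  simp [form, sub_dotProduct]

theorem form_sub_right (x y z : l ⊕ l → R) : form x (y - z) = form x y - form x z := by
  simp [form, mulVec_sub, dotProduct_sub]

theorem form_zero_left (x : l ⊕ l → R) : form 0 x = 0 := by simp [form]

theorem form_zero_right (x : l ⊕ l → R) : form x 0 = 0 := by simp [form]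

theorem form_self (x : l ⊕ l → R) : form x x = 0 := by
  rw [form_eq_sum]
  exact Finset.sum_eq_zero fun i _ => by ring

theorem form_swap (x y : l ⊕ l → R) : form x y = -form y x := by
  rw [form_eq_sum, form_eq_sum, ← Finset.sum_neg_distrib]
  exact Finset.sum_congr rfl fun i _ => by ring

/-- The standard basis vectors. -/
def E (R : Type*) [CommRing R] (p : l ⊕ l) : l ⊕ l → R := Pi.single p 1

theorem form_E_left (p : l ⊕ l) (x : l ⊕ l → R) : form (E R p) x = sgn p * x p.swap := by
  rcases p with i | i <;>
    simp [form_eq_sum, E, sgn, Pi.single_apply]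

theorem form_E_right (p : l ⊕ l) (x : l ⊕ l → R) : form x (E R p) = -(sgn p * x p.swap) := by
  rw [form_swap, form_E_left]

theorem form_E_E (p q : l ⊕ l) :
    form (E R p) (E R q) = if q = p.swap then (sgn p : R) else 0 := by
  rw [form_E_left, E, Pi.single_apply]
  by_cases h : q = p.swap <;> simp [h, eq_comm]

theorem mulVec_E (M : Matrix (l ⊕ l) (l ⊕ l) R) (p : l ⊕ l) : M *ᵥ E R p = M.col p := by
  simp [E]

theorem eq_zero_of_form {x : l ⊕ l → R} (h : ∀ y, form x y = 0) : x = 0 := by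
  ext p
  have := h (E R p.swap)
  rw [form_E_right] at this
  rcases p with i | i <;> simpa [sgn] using this

theorem eq_of_form {x x' : l ⊕ l → R} (h : ∀ p, form x (E R p) = form x' (E R p)) : x = x' := by
  ext p
  have := h p.swap
  rw [form_E_right, form_E_right] at this
  rcases p with i | i <;> simpa [sgn] using this

theorem form_mulVec_transpose (A : Matrix (l ⊕ l) (l ⊕ l) R) (x y : l ⊕ l → R) :
    form (A *ᵥ x) (A *ᵥ y) = x ⬝ᵥ (Aᵀ * J l R * A) *ᵥ y := by
  rw [form, ← Matrix.mulVec_mulVec, ← Matrix.mulVec_mulVec, dotProduct_mulVec x,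
    vecMul_transpose]

theorem transpose_mul_J_mul_iff {A : Matrix (l ⊕ l) (l ⊕ l) R} {c : R} :
    Aᵀ * J l R * A = c • J l R ↔ ∀ x y, form (A *ᵥ x) (A *ᵥ y) = c * form x y := by
  constructor
  · intro h x y
    rw [form_mulVec_transpose, h, form, Matrix.smul_mulVec, dotProduct_smul, smul_eq_mul]
  · intro h
    ext p q
    have := h (E R p) (E R q)
    rw [form_mulVec_transpose, form, E, E] at this
    simpa [Matrix.mulVec_single_one, single_one_dotProduct] using this

theorem mem_iff_form {A : Matrix (l ⊕ l) (l ⊕ l) R} :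
    A ∈ symplecticGroup l R ↔ ∀ x y, form (A *ᵥ x) (A *ᵥ y) = form x y := by
  rw [SymplecticGroup.mem_iff']
  simpa using transpose_mul_J_mul_iff (A := A) (c := (1 : R))

theorem form_mulVec (g : symplecticGroup l R) (x y : l ⊕ l → R) :
    form (g.1 *ᵥ x) (g.1 *ᵥ y) = form x y :=
  mem_iff_form.1 g.2 x y

theorem ext_mulVec {A B : Matrix (l ⊕ l) (l ⊕ l) R} (h : ∀ x, A *ᵥ x = B *ᵥ x) : A = B := by
  ext p q
  have := congrFun (h (Pi.single q 1)) p
  simpa using this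

theorem group_ext {g h : symplecticGroup l R} (H : ∀ x, g.1 *ᵥ x = h.1 *ᵥ x) : g = h :=
  Subtype.ext (ext_mulVec H)

theorem mul_mulVec (g h : symplecticGroup l R) (x : l ⊕ l → R) :
    (g * h).1 *ᵥ x = g.1 *ᵥ (h.1 *ᵥ x) := by
  rw [Matrix.mulVec_mulVec]; rfl

theorem one_mulVec' (x : l ⊕ l → R) : (1 : symplecticGroup l R).1 *ᵥ x = x :=
  Matrix.one_mulVec x

theorem inv_mulVec_mulVec (g : symplecticGroup l R) (x : l ⊕ l → R) :
    (g⁻¹).1 *ᵥ (g.1 *ᵥ x) = x := by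
  rw [← mul_mulVec, inv_mul_cancel, one_mulVec']

theorem mulVec_inv_mulVec (g : symplecticGroup l R) (x : l ⊕ l → R) :
    g.1 *ᵥ ((g⁻¹).1 *ᵥ x) = x := by
  rw [← mul_mulVec, mul_inv_cancel, one_mulVec']

/-- The matrix of the transvection `x ↦ x + c * form v x • v`. -/
def transvectionMatrix (c : R) (v : l ⊕ l → R) : Matrix (l ⊕ l) (l ⊕ l) R :=
  1 + c • vecMulVec v (v ᵥ* J l R)

theorem transvectionMatrix_mulVec (c : R) (v x : l ⊕ l → R) :
    transvectionMatrix c v *ᵥ x = x + (c * form v x) • v := by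
  rw [transvectionMatrix, add_mulVec, one_mulVec, smul_mulVec, vecMulVec_mulVec,
    ← dotProduct_mulVec, ← form]
  ext p
  simp
  ring

/-- The symplectic transvection `x ↦ x + c * form v x • v`. -/
def T (c : R) (v : l ⊕ l → R) : symplecticGroup l R :=
  ⟨transvectionMatrix c v, mem_iff_form.2 fun x y => by
    simp only [transvectionMatrix_mulVec, form_add_left, form_add_right, form_smul_left,
      form_smul_right, form_self]
    rw [form_swap x v]
    ring⟩

theorem T_mulVec (c : R) (v x : l ⊕ l → R) : (T c v).1 *ᵥ x = x + (c * form v x) • v :=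
  transvectionMatrix_mulVec c v x

theorem T_mul (c d : R) (v : l ⊕ l → R) : T c v * T d v = T (c + d) v := by
  refine group_ext fun x => ?_
  simp only [mul_mulVec, T_mulVec, form_add_right, form_smul_right, form_self]
  ext p
  simp
  ring

theorem T_zero (v : l ⊕ l → R) : T 0 v = 1 :=
  group_ext fun x => by simp [T_mulVec]

theorem T_inv (c : R) (v : l ⊕ l → R) : (T c v)⁻¹ = T (-c) v :=
  inv_eq_of_mul_eq_one_right (by rw [T_mul, add_neg_cancel, T_zero])

theorem T_pow (c : R) (v : l ⊕ l → R) (k : ℕ) : T c v ^ k = T (k * c) v := by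
  induction k with
  | zero => simp [T_zero]
  | succ k ih => rw [pow_succ, ih, T_mul]; congr 1; push_cast; ring

theorem T_zpow (c : R) (v : l ⊕ l → R) (k : ℤ) : T c v ^ k = T (k * c) v := by
  cases k with
  | ofNat k => simp [T_pow]
  | negSucc k => rw [zpow_negSucc, T_pow, T_inv]; congr 1; push_cast; ring

theorem T_neg (c : R) (v : l ⊕ l → R) : T c (-v) = T c v :=
  group_ext fun x => by simp [T_mulVec, form_neg_left]

theorem mul_T (g : symplecticGroup l R) (c : R) (v : l ⊕ l → R) :
    g * T c v = T c (g.1 *ᵥ v) * g := by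
  refine group_ext fun x => ?_
  simp only [mul_mulVec, T_mulVec, form_mulVec, mulVec_add, mulVec_smul]

theorem conj_T (g : symplecticGroup l R) (c : R) (v : l ⊕ l → R) :
    g * T c v * g⁻¹ = T c (g.1 *ᵥ v) := by
  rw [mul_T, mul_inv_cancel_right]

theorem commute_T {v w : l ⊕ l → R} (h : form v w = 0) (c d : R) : Commute (T c v) (T d w) := by
  rw [Commute, SemiconjBy, mul_T, T_mulVec, h]
  simp

/-- Together with `form_sq_of_braid`, this makes a pairing of `±1` visible in the group structure,
hence to automorphisms. -/
theorem braid_T {c : R} {v w : l ⊕ l → R} (h : form v w * form v w = 1) (hc : c * c = 1) :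
    T c v * T c w * T c v = T c w * T c v * T c w := by
  refine group_ext fun x => ?_
  simp only [mul_mulVec, T_mulVec, form_self, form_add_right, form_smul_right]
  rw [form_swap w v]
  ext p
  simp only [Pi.add_apply, Pi.smul_apply, smul_eq_mul]
  linear_combination (-(c * form v x * v p - c * form w x * w p)) * (hc + c * c * h)

variable [IsDomain R]

/-- Applied to `v`, the two products differ by `c * d * form w v * form v w` times `v`. -/
theorem form_eq_zero_of_commute {c d : R} {v w : l ⊕ l → R} (hc : c ≠ 0) (hd : d ≠ 0)
    (h : Commute (T c v) (T d w)) : form v w = 0 := by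
  by_contra h0
  have h1 := congrArg (fun g : symplecticGroup l R => g.1 *ᵥ v) h.eq
  simp only [mul_mulVec, T_mulVec, form_self, form_add_right, form_smul_right] at h1
  have h2 : (c * d * form w v * form v w) • v = 0 := by
    ext p
    have := congrFun h1 p
    simp only [Pi.add_apply, Pi.smul_apply, smul_eq_mul, Pi.zero_apply] at this ⊢
    linear_combination this
  rw [form_swap w v] at h2
  have : v = 0 := by
    rcases smul_eq_zero.1 h2 with h2 | h2
    · simp_all
    · exact h2
  exact h0 (by rw [this, form_zero_left])

/-- A transvection determines all products `v p * v q`, hence `v` up to sign. -/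
theorem eq_or_eq_neg_of_T_eq {c : R} {v w : l ⊕ l → R} (hc : c ≠ 0) (h : T c v = T c w) :
    v = w ∨ v = -w := by
  have key : ∀ p q, v p * v q = w p * w q := by
    intro p q
    have h1 := congrFun (congrArg (fun g : symplecticGroup l R => g.1 *ᵥ E R q.swap) h) p
    simp only [T_mulVec, form_E_right, Pi.add_apply, Pi.smul_apply, smul_eq_mul] at h1
    have h2 : c * (v p * v q) = c * (w p * w q) := by
      rcases q with i | i <;> simp [sgn] at h1 <;> linear_combination h1
    exact mul_left_cancel₀ hc h2
  by_cases h0 : ∃ p, v p ≠ 0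
  · obtain ⟨p, hp⟩ := h0
    have := key p p
    rcases mul_self_eq_mul_self_iff.1 this with h1 | h1
    · left; ext q
      have := key p q
      rw [← h1] at this
      exact mul_left_cancel₀ hp this
    · right; ext q
      have := key p q
      rw [show w p = -v p by rw [h1, neg_neg]] at this
      refine mul_left_cancel₀ hp ?_
      rw [this]; simp
  · push Not at h0
    left; ext q
    have := key q q
    rw [h0 q] at this ⊢
    simpa [eq_comm] using this

/-- Both words are evaluated at `v`. A nonzero pairing is required because the relation also holds
trivially for `w = ±v`. -/
theorem form_sq_of_braid {c : R} {v w : l ⊕ l → R} (hc : c * c = 1) (h0 : form v w ≠ 0)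
    (h : T c v * T c w * T c v = T c w * T c v * T c w) : form v w * form v w = 1 := by
  have h1 := congrArg (fun g : symplecticGroup l R => g.1 *ᵥ v) h
  simp only [mul_mulVec, T_mulVec, form_self, form_add_right, form_smul_right] at h1
  rw [form_swap w v] at h1
  have hc0 : c ≠ 0 := by rintro rfl; simp at hc
  have h2 : (form v w * c * (form v w * form v w - 1)) • w = 0 := by
    ext p
    have := congrFun h1 p
    simp only [Pi.add_apply, Pi.smul_apply, smul_eq_mul, Pi.zero_apply] at this ⊢
    linear_combination (-1) * this - c * form v w ^ 3 * w p * hc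
  rcases smul_eq_zero.1 h2 with h2 | h2
  · have h3 := mul_ne_zero h0 hc0
    linear_combination (mul_eq_zero.1 h2).resolve_left h3
  · exact absurd (by rw [h2, form_zero_right]) h0

end Form

/-! ### Primitive vectors, transitivity and the recognition of transvections -/

section Primitive

variable {l : Type*} [Fintype l] [DecidableEq l]

/-- Primitive integral vectors, characterized through the unimodular form. -/
def Primitive (v : l ⊕ l → ℤ) : Prop := ∃ y, form v y = 1

theorem Primitive.mulVec {v : l ⊕ l → ℤ} (h : Primitive v) (g : symplecticGroup l ℤ) :
    Primitive (g.1 *ᵥ v) := by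
  obtain ⟨y, hy⟩ := h
  exact ⟨g.1 *ᵥ y, by rw [form_mulVec, hy]⟩

theorem primitive_of_form_sq {v y : l ⊕ l → ℤ} (h : form v y * form v y = 1) : Primitive v :=
  ⟨form v y • y, by rw [form_smul_right, h]⟩

theorem Primitive.ne_zero {v : l ⊕ l → ℤ} (h : Primitive v) : v ≠ 0 := by
  rintro rfl
  obtain ⟨y, hy⟩ := h
  simp [form_zero_left] at hy

theorem primitive_E (p : l ⊕ l) : Primitive (E ℤ p) :=
  primitive_of_form_sq (y := E ℤ p.swap) (by rw [form_E_E, if_pos rfl]; exact_mod_cast sgn_mul_self p)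

theorem ext_mulVec_E {R : Type*} [CommRing R] {A B : Matrix (l ⊕ l) (l ⊕ l) R}
    (h : ∀ p, A *ᵥ E R p = B *ᵥ E R p) : A = B := by
  ext a q
  simpa [mulVec_E] using congrFun (h q) a

theorem swap_ne {l : Type*} {p q : l ⊕ l} (h : p ≠ q) : p.swap ≠ q.swap := fun h' =>
  h (by simpa using congrArg Sum.swap h')

theorem exists_sign_natAbs_lt {a b : ℤ} (hb : b ≠ 0) (h : b.natAbs ≤ a.natAbs) :
    ∃ c : ℤ, (c = 1 ∨ c = -1) ∧ (a + c * b).natAbs < a.natAbs := by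
  rcases lt_or_ge 0 (a * b) with h1 | h1
  · refine ⟨-1, Or.inr rfl, ?_⟩
    rcases pos_and_pos_or_neg_and_neg_of_mul_pos h1 with h2 | h2 <;> omega
  · refine ⟨1, Or.inl rfl, ?_⟩
    rcases lt_trichotomy a 0 with ha | ha | ha
    · have : 0 ≤ b := by by_contra hb'; nlinarith
      omega
    · omega
    · have : b ≤ 0 := by by_contra hb'; nlinarith
      omega

theorem sum_natAbs_lt_of_add_E {v : l ⊕ l → ℤ} {r : l ⊕ l} {c : ℤ}
    (h : (v r + c).natAbs < (v r).natAbs) :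
    ∑ p, ((v + c • E ℤ r) p).natAbs < ∑ p, (v p).natAbs := by
  refine Finset.sum_lt_sum (fun p _ => ?_) ⟨r, Finset.mem_univ _, by simpa [E] using h⟩
  by_cases hp : p = r
  · subst hp; simpa [E] using h.le
  · simp [E, hp]

/-- The Euclidean algorithm for the transvections in `E p` and `E p + E q`. -/
theorem euclid (P : (l ⊕ l → ℤ) → Prop)
    (h1 : ∀ p v, ∀ c : ℤ, (c = 1 ∨ c = -1) → P ((T c (E ℤ p)).1 *ᵥ v) → P v)
    (h2 : ∀ p q v, q ≠ p → q ≠ p.swap → ∀ c : ℤ, (c = 1 ∨ c = -1) →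
      P ((T c (E ℤ p + E ℤ q)).1 *ᵥ v) → P v)
    (h3 : ∀ p, P (E ℤ p) ∧ P (-E ℤ p)) {v : l ⊕ l → ℤ} (hv : Primitive v) : P v := by
  induction hN : ∑ p, (v p).natAbs using Nat.strong_induction_on generalizing v with
  | _ N ih =>
  subst hN
  have hneg : ∀ c : ℤ, (c = 1 ∨ c = -1) → (-c = 1 ∨ -c = -1) := by rintro c (rfl | rfl) <;> simp
  have hsgn : ∀ (c : ℤ) (p : l ⊕ l), (c = 1 ∨ c = -1) → (c * sgn p = 1 ∨ c * sgn p = -1) := by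
    rintro c p (rfl | rfl) <;> rcases sgn_cases p with h | h <;> simp [h]
  -- The transvection in `E r` changes only the coordinate `r`, by a multiple of the coordinate
  -- `r.swap`: a Euclidean step inside one hyperbolic plane.
  by_cases hA : ∃ r, v r.swap ≠ 0 ∧ (v r.swap).natAbs ≤ (v r).natAbs
  · obtain ⟨r, hr0, hr⟩ := hA
    obtain ⟨c, hc, hlt⟩ := exists_sign_natAbs_lt hr0 hr
    refine h1 r v _ (hsgn c r hc) (ih _ ?_ (hv.mulVec _) rfl)
    rw [T_mulVec, form_E_left]
    refine sum_natAbs_lt_of_add_E ?_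
    have : c * sgn r * (↑(sgn r) * v r.swap) = c * v r.swap := by
      linear_combination c * v r.swap * sgn_mul_self r
    rwa [Int.cast_id, this]
  have hA' : ∀ r, v r ≠ 0 → v r.swap = 0 := by
    intro r hr
    by_contra h
    rcases le_total (v r.swap).natAbs (v r).natAbs with h' | h'
    · exact hA ⟨r, h, h'⟩
    · exact hA ⟨r.swap, by simpa using hr, by simpa using h'⟩
  -- Each hyperbolic plane now carries at most one nonzero coordinate, so remaining reductions
  -- combine different planes.
  by_cases hB : ∃ r s, r ≠ s ∧ v s ≠ 0 ∧ (v s).natAbs ≤ (v r).natAbs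
  · obtain ⟨r, s, hrs, hs, hle⟩ := hB
    obtain ⟨c, hc, hlt⟩ := exists_sign_natAbs_lt hs hle
    have hr : v r ≠ 0 := by intro h; simp [h] at hle; exact hs hle
    have hr' := hA' r hr
    have hsr : s ≠ r.swap := by rintro rfl; exact hs hr'
    set c' := c * sgn s.swap with hc'
    have hcc := hsgn c s.swap hc
    -- The mixed transvection adds `c * v s` times `E r + E s.swap`, since `v r.swap = 0`; the
    -- transvection in `E s.swap` removes the unwanted part, and the one in `E r` acts trivially
    -- here.
    have e : (T (-c') (E ℤ s.swap)).1 *ᵥ ((T (-c') (E ℤ r)).1 *ᵥ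
        ((T c' (E ℤ r + E ℤ s.swap)).1 *ᵥ v)) = v + (c * v s) • E ℤ r := by
      have f1 : form (E ℤ r) (E ℤ s.swap) = 0 := by
        rw [form_E_E, if_neg (swap_ne hrs.symm)]
      have f2 : form (E ℤ s.swap) (E ℤ r) = 0 := by rw [form_swap, f1, neg_zero]
      have f3 : form (E ℤ r) v = 0 := by rw [form_E_left, hr', mul_zero]
      have f4 : form (E ℤ s.swap) v = sgn s.swap * v s := by rw [form_E_left]; simp
      simp only [T_mulVec, form_add_left, form_add_right, form_smul_right, f1, f2,
        f3, form_self, f4]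
      ext p
      simp only [Pi.add_apply, Pi.smul_apply, smul_eq_mul]
      linear_combination (c * v s * E ℤ r p) * sgn_mul_self s.swap
    refine h2 r s.swap v ?_ (swap_ne hrs.symm) c' hcc (h1 r _ _ (hneg _ hcc)
      (h1 s.swap _ _ (hneg _ hcc) (ih _ ?_ (((hv.mulVec _).mulVec _).mulVec _) rfl)))
    · rintro h; apply hsr; rw [← h]; simp
    · rw [e]
      exact sum_natAbs_lt_of_add_E hlt
  · obtain ⟨y, hy⟩ := hv
    obtain ⟨r, hr⟩ : ∃ r, v r ≠ 0 := by
      by_contra h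
      push Not at h
      have : v = 0 := funext h
      simp [this, form_zero_left] at hy
    have hv : v = v r • E ℤ r := by
      ext s
      by_cases hs : s = r
      · subst hs; simp [E]
      · simp only [Pi.smul_apply, E, Pi.single_apply, hs, if_false, smul_zero]
        by_contra hs0
        rcases le_total (v s).natAbs (v r).natAbs with h' | h'
        · exact hB ⟨r, s, Ne.symm hs, hs0, h'⟩
        · exact hB ⟨s, r, hs, hr, h'⟩
    rw [hv, form_smul_left] at hy
    rcases Int.eq_one_or_neg_one_of_mul_eq_one hy with h | h
    · rw [hv, h, one_smul]; exact (h3 r).1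
    · rw [hv, h, neg_one_smul]; exact (h3 r).2

/-- The two transvections send `v` to `v + u` and then to `u`. -/
theorem exists_mulVec_eq_of_form {u v : l ⊕ l → ℤ} (h : form u v * form u v = 1) :
    ∃ g : symplecticGroup l ℤ, g.1 *ᵥ v = u := by
  refine ⟨T (form u v) v * T (form u v) u, ?_⟩
  simp only [mul_mulVec, T_mulVec, form_add_right, form_smul_right, form_self]
  rw [form_swap v u, h]
  ext p
  simp only [Pi.add_apply, Pi.smul_apply, smul_eq_mul]
  linear_combination (-v p) * h

/-- Transitivity of the symplectic group on primitive vectors. -/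
theorem exists_mulVec_E_eq (q : l ⊕ l) {v : l ⊕ l → ℤ} (hv : Primitive v) :
    ∃ g : symplecticGroup l ℤ, g.1 *ᵥ E ℤ q = v := by
  have back : ∀ (h : symplecticGroup l ℤ) (v : l ⊕ l → ℤ),
      (∃ g : symplecticGroup l ℤ, g.1 *ᵥ E ℤ q = h.1 *ᵥ v) →
      ∃ g : symplecticGroup l ℤ, g.1 *ᵥ E ℤ q = v := by
    rintro h v ⟨g, hg⟩
    exact ⟨h⁻¹ * g, by rw [mul_mulVec, hg, inv_mulVec_mulVec]⟩
  have two : ∀ (x v : l ⊕ l → ℤ), form (E ℤ q) x * form (E ℤ q) x = 1 → form v x * form v x = 1 →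
      ∃ g : symplecticGroup l ℤ, g.1 *ᵥ E ℤ q = v := by
    intro x v h1 h2
    obtain ⟨g, hg⟩ := exists_mulVec_eq_of_form h2
    obtain ⟨g', hg'⟩ := exists_mulVec_eq_of_form h1
    exact ⟨g * g'⁻¹, by rw [mul_mulVec, ← hg', inv_mulVec_mulVec, hg]⟩
  have sq : ∀ p : l ⊕ l, form (E ℤ p) (E ℤ p.swap) * form (E ℤ p) (E ℤ p.swap) = 1 := by
    intro p
    rw [form_E_E, if_pos rfl]; exact_mod_cast sgn_mul_self p
  -- A vector pairing to `±1` with both `E q` and `E p` links them through two applications of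
  -- `exists_mulVec_eq_of_form`.
  have pos : ∀ p, ∃ x, form (E ℤ q) x * form (E ℤ q) x = 1 ∧
      form (E ℤ p) x * form (E ℤ p) x = 1 := by
    intro p
    by_cases h1 : p = q
    · subst h1; exact ⟨_, sq p, sq p⟩
    by_cases h2 : p = q.swap
    · subst h2
      refine ⟨E ℤ q + E ℤ q.swap, ?_, ?_⟩
      · simpa only [form_add_right, form_self, zero_add] using sq q
      · have := sq q.swap
        simpa only [form_add_right, form_self, add_zero, Sum.swap_swap] using this
    · refine ⟨E ℤ p.swap + E ℤ q.swap, ?_, ?_⟩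
      · rw [form_add_right, form_E_E q p.swap, if_neg (swap_ne h1), zero_add]
        exact sq q
      · rw [form_add_right, form_E_E p q.swap, if_neg (swap_ne (Ne.symm h1)), add_zero]
        exact sq p
  refine euclid (fun v => ∃ g : symplecticGroup l ℤ, g.1 *ᵥ E ℤ q = v) (fun p v c _ => back _ v)
    (fun p r v _ _ c _ => back _ v) (fun p => ?_) hv
  obtain ⟨x, hx1, hx2⟩ := pos p
  exact ⟨two x _ hx1 hx2, two x _ hx1 (by rw [form_neg_left]; linear_combination hx2)⟩

theorem exists_mulVec_eq {v w : l ⊕ l → ℤ} (hv : Primitive v) (hw : Primitive w) :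
    ∃ g : symplecticGroup l ℤ, g.1 *ᵥ v = w := by
  have : ∃ p, v p ≠ 0 := by
    by_contra h
    push Not at h
    exact hv.ne_zero (funext h)
  obtain ⟨p, _⟩ := this
  obtain ⟨g, hg⟩ := exists_mulVec_E_eq p hv
  obtain ⟨h, hh⟩ := exists_mulVec_E_eq p hw
  exact ⟨h * g⁻¹, by rw [mul_mulVec, ← hg, inv_mulVec_mulVec, hh]⟩

/-- Every nonzero integral vector is a multiple of a primitive one. -/
theorem exists_primitive_smul {v : l ⊕ l → ℤ} (hv : v ≠ 0) :
    ∃ (d : ℤ) (w : l ⊕ l → ℤ), d ≠ 0 ∧ Primitive w ∧ v = d • w := by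
  let L : (l ⊕ l → ℤ) →ₗ[ℤ] ℤ :=
    { toFun := form v, map_add' := form_add_right v, map_smul' := fun c x => form_smul_right c v x }
  -- `d` generates the ideal of values of `form v`, so it divides every coordinate; a vector where
  -- the value `d` is attained witnesses primitivity of the quotient.
  obtain ⟨d, hd⟩ := IsPrincipalIdealRing.principal (LinearMap.range L)
  obtain ⟨y, hy⟩ : d ∈ LinearMap.range L := hd ▸ Submodule.mem_span_singleton_self d
  have hdvd : ∀ p, ∃ a, v p = d * a := by
    intro p
    have : form v (E ℤ p.swap) ∈ LinearMap.range L := ⟨_, rfl⟩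
    rw [hd, Submodule.mem_span_singleton, form_E_right] at this
    obtain ⟨a, ha⟩ := this
    have ha' : a * d = -(sgn p.swap * v p) := by simpa using ha
    exact ⟨-(sgn p.swap * a), by
      linear_combination sgn p.swap * ha' - v p * sgn_mul_self p.swap⟩
  choose w hw using hdvd
  have hvw : v = d • w := funext hw
  have hd0 : d ≠ 0 := by
    rintro rfl
    exact hv (by rw [hvw, zero_smul])
  refine ⟨d, w, hd0, ⟨y, ?_⟩, hvw⟩
  have : form v y = d := hy
  rw [hvw, form_smul_left] at this
  exact mul_left_cancel₀ hd0 (by rw [this, mul_one])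

/-- A symplectic matrix `1 + N` with `N` of rank one is a power of a transvection. -/
theorem exists_eq_T {g : symplecticGroup l ℤ} (hg : g ≠ 1) {u : l ⊕ l → ℤ}
    (h : ∀ x, ∃ a b : ℤ, a ≠ 0 ∧ a • (g.1 *ᵥ x - x) = b • u) :
    ∃ (c : ℤ) (w : l ⊕ l → ℤ), c ≠ 0 ∧ Primitive w ∧ g = T c w := by
  have hu : u ≠ 0 := by
    rintro rfl
    refine hg (group_ext fun x => ?_)
    obtain ⟨a, b, ha, hab⟩ := h x
    rw [smul_zero] at hab
    rw [one_mulVec', ← sub_eq_zero]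
    exact (smul_eq_zero.1 hab).resolve_left ha
  obtain ⟨d, w, hd, ⟨y, hy⟩, rfl⟩ := exists_primitive_smul hu
  -- Pairing with `y`, where `form w y = 1`, reads off the integral coefficient of `w`.
  have hN : ∀ x, g.1 *ᵥ x = x + form (g.1 *ᵥ x - x) y • w := by
    intro x
    obtain ⟨a, b, ha, hab⟩ := h x
    rw [← sub_eq_iff_eq_add']
    refine smul_right_injective _ ha ?_
    have := congrArg (fun z => form z y) hab
    simp only [form_smul_left, hy, mul_one] at this
    dsimp only
    rw [hab, smul_smul, smul_smul, this]
  set f : (l ⊕ l → ℤ) → ℤ := fun x => form (g.1 *ᵥ x - x) y with hf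
  -- Invariance of `form x y` under `g` makes this coefficient proportional to `form w x`.
  have hf' : ∀ x, f x = f y * form w x := by
    intro x
    have h1 := form_mulVec g x y
    rw [hN x, hN y] at h1
    simp only [form_add_left, form_add_right, form_smul_left, form_smul_right, form_self, hy] at h1
    rw [form_swap x w] at h1
    change f x = _
    have h2 : form (g.1 *ᵥ x - x) y = f x := rfl
    have h3 : form (g.1 *ᵥ y - y) y = f y := rfl
    rw [h2, h3] at h1
    linear_combination h1
  have hT : g = T (f y) w := by
    refine group_ext fun x => ?_
    rw [T_mulVec, ← hf', ← hN]
  refine ⟨f y, w, ?_, ⟨y, hy⟩, hT⟩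
  intro h0
  rw [h0, T_zero] at hT
  exact hg hT

/-- An element acting on all primitive vectors of a hyperplane by signs is, up to sign,
a power of a transvection. -/
theorem exists_T_of_forall_orthogonal {w : l ⊕ l → ℤ} (hw : Primitive w)
    (x : symplecticGroup l ℤ)
    (h : ∀ u, Primitive u → form w u = 0 → x.1 *ᵥ u = u ∨ x.1 *ᵥ u = -u) :
    ∃ (s m : ℤ), s * s = 1 ∧ x.1 = s • (T m w).1 := by
  obtain ⟨p, _⟩ : ∃ p, w p ≠ 0 := by
    by_contra h
    push Not at h
    exact hw.ne_zero (funext h)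
  wlog hwp : w = E ℤ p generalizing w x
  · obtain ⟨g, hg⟩ := exists_mulVec_E_eq p hw
    obtain ⟨s, m, hs, hm⟩ := this (primitive_E p) (g⁻¹ * x * g) (fun u hu hwu => by
      have := h (g.1 *ᵥ u) (hu.mulVec g) (by rw [← hg, form_mulVec, hwu])
      simp only [mul_mulVec]
      rcases this with h | h
      · left; rw [h, inv_mulVec_mulVec]
      · right; rw [h, Matrix.mulVec_neg, inv_mulVec_mulVec]) (by simp [E]) rfl
    refine ⟨s, m, hs, ext_mulVec fun y => ?_⟩
    have h1 := congrArg (fun M => g.1 *ᵥ (M *ᵥ ((g⁻¹).1 *ᵥ y))) hm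
    simp only [mul_mulVec, mulVec_inv_mulVec, smul_mulVec, mulVec_smul] at h1
    rw [h1, ← hg, ← conj_T, smul_mulVec, mul_mulVec, mul_mulVec]
  subst hwp
  have hE : ∀ q, q ≠ p.swap → x.1 *ᵥ E ℤ q = E ℤ q ∨ x.1 *ᵥ E ℤ q = -E ℤ q := fun q hq =>
    h _ (primitive_E q) (by rw [form_E_E, if_neg hq])
  obtain ⟨s, hs, hsp⟩ : ∃ s : ℤ, s * s = 1 ∧ x.1 *ᵥ E ℤ p = s • E ℤ p := by
    rcases hE p (by cases p <;> simp) with h | h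
    · exact ⟨1, by norm_num, by simpa using h⟩
    · exact ⟨-1, by norm_num, by simpa using h⟩
  -- The signs on `E p` and `E q` agree because `E p + E q` is again primitive and orthogonal to `E
  -- p`.
  have hall : ∀ q, q ≠ p.swap → x.1 *ᵥ E ℤ q = s • E ℤ q := by
    intro q hq
    by_cases hqp : q = p
    · rw [hqp, hsp]
    have hprim : Primitive (E ℤ p + E ℤ q) := primitive_of_form_sq (y := E ℤ p.swap) (by
      rw [form_add_left, form_E_E q, if_neg (swap_ne (Ne.symm hqp)), form_E_E, if_pos rfl, add_zero]
      exact_mod_cast sgn_mul_self p)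
    have h1 := h _ hprim (by rw [form_add_right, form_self, form_E_E, if_neg hq, zero_add])
    rw [mulVec_add, hsp] at h1
    have e1 : E ℤ p p = 1 := by simp [E]
    have e2 : E ℤ q q = 1 := by simp [E]
    have e3 : E ℤ p q = 0 := by simp [E, hqp]
    have e4 : E ℤ q p = 0 := by simp [E, Ne.symm hqp]
    have hq' := hE q hq
    rcases hq' with h2 | h2 <;> rw [h2] at h1 ⊢ <;> rcases h1 with h1 | h1 <;>
      have k1 := congrFun h1 p <;> have k2 := congrFun h1 q <;>
      simp [e1, e2, e3, e4] at k1 k2 <;> first | omega | (subst k1; simp)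
  have hfix : ∀ q, q ≠ p.swap → form (x.1 *ᵥ E ℤ p.swap - s • E ℤ p.swap) (E ℤ q) = 0 := by
    intro q hq
    have h1 := form_mulVec x (E ℤ p.swap) (E ℤ q)
    rw [hall q hq, form_smul_right] at h1
    rw [form_sub_left, form_smul_left]
    linear_combination s * h1 - form (x.1 *ᵥ E ℤ p.swap) (E ℤ q) * hs
  set z := x.1 *ᵥ E ℤ p.swap - s • E ℤ p.swap with hz
  -- `z` is orthogonal to every basis vector except possibly `E p.swap`, which leaves only its
  -- coordinate at `p`.
  have hzp : z = z p • E ℤ p := by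
    ext q
    by_cases hq : q = p
    · subst hq; simp [E]
    · have := hfix q.swap (swap_ne hq)
      rw [form_E_right] at this
      have : z q = 0 := by rcases q with i | i <;> simpa [sgn] using this
      simp [this, E, hq]
  refine ⟨s, s * z p * sgn p, hs, ?_⟩
  refine ext_mulVec_E fun q => ?_
  rw [smul_mulVec, T_mulVec, form_E_E]
  by_cases hq : q = p.swap
  · subst hq
    have hx : x.1 *ᵥ E ℤ p.swap = s • E ℤ p.swap + z p • E ℤ p := by
      rw [← hzp, hz, add_sub_cancel]
    rw [if_pos rfl, hx]
    ext r
    simp only [Pi.add_apply, Pi.smul_apply, smul_eq_mul, Int.cast_id]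
    linear_combination (-(z p * E ℤ p r)) * (sgn p * sgn p * hs + sgn_mul_self p)
  · rw [hall q hq, if_neg hq]; simp

/-- If `φ` maps some power of a transvection to a power of a transvection, then it maps
transvections to transvections or their inverses, up to sign. -/
theorem map_T_of_map_T {φ : MulAut (symplecticGroup l ℤ)} {v w : l ⊕ l → ℤ} {k c : ℤ}
    (hw : Primitive w) (hk : k ≠ 0) (h : φ (T k v) = T c w) :
    ∃ (s m : ℤ), s * s = 1 ∧ (φ (T 1 v)).1 = s • (T m w).1 := by
  -- For `u` orthogonal to `w`, the preimage `y` of `T 1 u` commutes with `T k v`, so it sends `v`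
  -- to `±v` and commutes with `T 1 v`. Applying `φ`, `φ (T 1 v)` commutes with `T 1 u` and
  -- therefore sends `u` to `±u`.
  refine exists_T_of_forall_orthogonal hw _ fun u hu hwu => ?_
  have h1 : Commute (φ.symm (T 1 u)) (T k v) := by
    have : Commute (T 1 u) (φ (T k v)) := by
      rw [h]; exact commute_T (by rw [form_swap, hwu, neg_zero]) _ _
    simpa using this.map φ.symm
  set y := φ.symm (T 1 u) with hy
  have h2 : y.1 *ᵥ v = v ∨ y.1 *ᵥ v = -v := by
    refine eq_or_eq_neg_of_T_eq hk ?_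
    rw [← conj_T, h1.eq, mul_inv_cancel_right]
  have h3 : Commute y (T 1 v) := by
    rw [Commute, SemiconjBy, mul_T]
    rcases h2 with h2 | h2 <;> rw [h2]
    rw [T_neg]
  have h4 : Commute (φ (T 1 v)) (T 1 u) := by
    have := (h3.map φ).symm
    simpa [hy] using this
  refine eq_or_eq_neg_of_T_eq one_ne_zero ?_
  rw [← conj_T, h4.eq, mul_inv_cancel_right]

/-- The previous result applies to both `φ` and its inverse. Squaring removes the signs, and
comparing exponents gives `m * m' = 1`. -/
theorem map_T_eq_sign {φ : MulAut (symplecticGroup l ℤ)} {v w : l ⊕ l → ℤ} {k c : ℤ}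
    (hv : Primitive v) (hw : Primitive w) (hk : k ≠ 0) (hc : c ≠ 0) (h : φ (T k v) = T c w) :
    ∃ (s d : ℤ), s * s = 1 ∧ d * d = 1 ∧ (φ (T 1 v)).1 = s • (T d w).1 := by
  obtain ⟨s, m, hs, hm⟩ := map_T_of_map_T hw hk h
  obtain ⟨s', m', hs', hm'⟩ := map_T_of_map_T (φ := φ.symm) hv hc
    (by rw [← h]; exact φ.symm_apply_apply _)
  have sq : ∀ (x : symplecticGroup l ℤ) (s m : ℤ) (v : l ⊕ l → ℤ), s * s = 1 →
      x.1 = s • (T m v).1 → x ^ 2 = T (2 * m) v := by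
    intro x s m v hs hx
    apply Subtype.ext
    rw [pow_two, Submonoid.coe_mul, hx, smul_mul_smul_comm, hs, one_smul, ← Submonoid.coe_mul, T_mul,
      two_mul]
  have h1 := sq _ _ _ _ hs hm
  have h2 := sq _ _ _ _ hs' hm'
  have h3 : T 2 w = T (m * m' * 2) w := by
    have := congrArg φ h2
    rw [map_pow, MulEquiv.apply_symm_apply, T_pow] at this
    have e : T (2 * m') v = (T 1 v ^ 2) ^ m' := by
      rw [T_pow, T_zpow]; congr 1; push_cast; ring
    rw [e, map_zpow, map_pow, h1, T_zpow] at this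
    convert this using 2
    · norm_num
    · rw [Int.cast_id]; ring
  obtain ⟨y, hy⟩ := hw
  have h4 := congrArg (fun g : symplecticGroup l ℤ => form (g.1 *ᵥ y) y) h3
  simp only [T_mulVec, form_add_left, form_smul_left, hy, form_self] at h4
  have h5 : m * m' = 1 := by linarith
  rcases Int.eq_one_or_neg_one_of_mul_eq_one h5 with h | h
  · exact ⟨s, m, hs, by rw [h]; rfl, hm⟩
  · exact ⟨s, m, hs, by rw [h]; rfl, hm⟩

end Primitive

/-! ### Automorphisms respecting transvections -/

section Similitude

variable {l : Type*} [Fintype l] [DecidableEq l]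

theorem form_mulVec_of_E {A : Matrix (l ⊕ l) (l ⊕ l) ℤ} {c : ℤ}
    (h : ∀ p q, form (A *ᵥ E ℤ p) (A *ᵥ E ℤ q) = c * form (E ℤ p) (E ℤ q)) (x y : l ⊕ l → ℤ) :
    form (A *ᵥ x) (A *ᵥ y) = c * form x y := by
  revert x y
  rw [← transpose_mul_J_mul_iff]
  ext p q
  have := h p q
  rw [form_mulVec_transpose, form, E, E] at this
  simpa [Matrix.mulVec_single_one, single_one_dotProduct] using this

/-- An integral similitude of the form with multiplier `d`, where `d * d = 1`, is invertible. -/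
theorem exists_inverse_of_similitude {g : Matrix (l ⊕ l) (l ⊕ l) ℤ} {d : ℤ} (hd : d * d = 1)
    (hg : ∀ x y, form (g *ᵥ x) (g *ᵥ y) = d * form x y) :
    ∃ h : Matrix (l ⊕ l) (l ⊕ l) ℤ, h * g = 1 ∧ g * h = 1 := by
  have h1 := transpose_mul_J_mul_iff.2 hg
  -- From `gᵀ J g = d J` and `J² = -1`, the inverse is `-d J gᵀ J`.
  have h2 : (-d) • (J l ℤ * gᵀ * J l ℤ) * g = 1 := by
    rw [smul_mul_assoc, Matrix.mul_assoc, Matrix.mul_assoc, ← Matrix.mul_assoc gᵀ, h1,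
      mul_smul_comm, J_squared, smul_smul, smul_neg, neg_mul, hd, neg_smul, one_smul, neg_neg]
  exact ⟨_, h2, mul_eq_one_comm.1 h2⟩

theorem similitude_mul_T {g : Matrix (l ⊕ l) (l ⊕ l) ℤ} {d : ℤ} (hd : d * d = 1)
    (hg : ∀ x y, form (g *ᵥ x) (g *ᵥ y) = d * form x y) (c : ℤ) (v : l ⊕ l → ℤ) :
    g * (T c v).1 = (T (d * c) (g *ᵥ v)).1 * g := by
  refine ext_mulVec fun x => ?_
  rw [← mulVec_mulVec, ← mulVec_mulVec, T_mulVec, T_mulVec, hg, mulVec_add, mulVec_smul]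
  congr 2
  linear_combination (-c * form v x) * hd

/-- `φ` maps transvections to `d`-th powers of transvections, up to the sign `s`. -/
def MapsTransvections (φ : MulAut (symplecticGroup l ℤ)) (s d : ℤ) : Prop :=
  ∀ v, Primitive v → ∃ w, (φ (T 1 v)).1 = s • (T d w).1

/-! ### Coherent choice of image vectors -/

section Image

variable {φ : MulAut (symplecticGroup l ℤ)} {s d : ℤ} (hs : s * s = 1) (hd : d * d = 1)
  {v w v' w' : l ⊕ l → ℤ}

include hs hd

/-- Orthogonality is commutation of transvections, and the two factors `s` cancel in a product. -/
theorem form_eq_zero_of_map (h : (φ (T 1 v)).1 = s • (T d w).1)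
    (h' : (φ (T 1 v')).1 = s • (T d w').1) (h0 : form v v' = 0) : form w w' = 0 := by
  have hd0 : d ≠ 0 := by rintro rfl; simp at hd
  refine form_eq_zero_of_commute hd0 hd0 ?_
  have h1 := congrArg Subtype.val ((commute_T h0 1 1).map φ).eq
  rw [Submonoid.coe_mul, Submonoid.coe_mul, h, h', smul_mul_smul_comm, smul_mul_smul_comm, hs,
    one_smul, one_smul] at h1
  exact Subtype.ext h1

/-- Both sides of the braid relation carry the same factor `s³`. Injectivity of `φ` excludes a zero
pairing, since commuting images would make the original transvections commute. -/
theorem form_sq_of_map (h : (φ (T 1 v)).1 = s • (T d w).1)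
    (h' : (φ (T 1 v')).1 = s • (T d w').1) (h0 : form v v' * form v v' = 1) :
    form w w' * form w w' = 1 := by
  have hs0 : s ≠ 0 := by rintro rfl; simp at hs
  refine form_sq_of_braid hd (fun h1 => ?_) ?_
  · have h2 : Commute (φ (T 1 v)) (φ (T 1 v')) := by
      refine Subtype.ext ?_
      rw [Submonoid.coe_mul, Submonoid.coe_mul, h, h', smul_mul_smul_comm, smul_mul_smul_comm]
      congr 1
      exact congrArg Subtype.val (commute_T h1 d d).eq
    have h3 : Commute (T 1 v) (T 1 v') := by simpa using h2.map φ.symm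
    have := form_eq_zero_of_commute one_ne_zero one_ne_zero h3
    rw [this] at h0
    simp at h0
  · have h1 := congrArg (fun x => (φ x).1) (braid_T h0 (one_mul (1 : ℤ)))
    simp only [map_mul, Submonoid.coe_mul, h, h', smul_mul_smul_comm] at h1
    have h2 := smul_right_injective _ (mul_ne_zero (mul_ne_zero hs0 hs0) hs0) h1
    exact Subtype.ext h2

/-- The image vector is determined only up to sign; the sign is chosen to give the prescribed
pairing. -/
theorem exists_map_form_eq (hφ : MapsTransvections φ s d) {u : l ⊕ l → ℤ} (hu : Primitive u)
    (h : (φ (T 1 v)).1 = s • (T d w).1) (h0 : form u v * form u v = 1) :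
    ∃ w', (φ (T 1 u)).1 = s • (T d w').1 ∧ form w' w = d * form u v := by
  obtain ⟨w', hw'⟩ := hφ u hu
  have h1 := form_sq_of_map hs hd hw' h h0
  have h2 : form w' w = d * form u v ∨ form w' w = -(d * form u v) := by
    refine mul_self_eq_mul_self_iff.1 ?_
    rw [h1, mul_mul_mul_comm, hd, h0, one_mul]
  rcases h2 with h2 | h2
  · exact ⟨w', hw', h2⟩
  · exact ⟨-w', by rw [T_neg, hw'], by rw [form_neg_left, h2, neg_neg]⟩

/-- There is an integral similitude `g` realizing the action of `φ` on a generating set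
of transvections. -/
theorem exists_similitude (hφ : MapsTransvections φ s d) (i₀ : l) :
    ∃ g : Matrix (l ⊕ l) (l ⊕ l) ℤ, (∀ x y, form (g *ᵥ x) (g *ᵥ y) = d * form x y) ∧
      (∀ p, (φ (T 1 (E ℤ p))).1 = s • (T d (g *ᵥ E ℤ p)).1) ∧
      ∀ i, i ≠ i₀ → (φ (T 1 (E ℤ (.inl i₀) + E ℤ (.inl i)))).1 =
        s • (T d (g *ᵥ (E ℤ (.inl i₀) + E ℤ (.inl i)))).1 := by
  have sq : ∀ i : l, form (E ℤ (.inl i)) (E ℤ (.inr i)) * form (E ℤ (.inl i)) (E ℤ (.inr i)) = 1 := by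
    intro i; simp [form_E_E, sgn]
  obtain ⟨f₀, hf₀⟩ := hφ _ (primitive_E (.inr i₀))
  obtain ⟨e₀, he₀, hef₀⟩ := exists_map_form_eq hs hd hφ (primitive_E (.inl i₀)) hf₀ (sq i₀)
  -- For `i ≠ i₀`, signs are fixed along a chain: `c`, the image vector of the sum, against `f₀`,
  -- then `f` against `c`, then `e` against `f`. This ties plane `i` to plane `i₀`.
  have key : ∀ i, ∃ e f, (φ (T 1 (E ℤ (.inl i)))).1 = s • (T d e).1 ∧
      (φ (T 1 (E ℤ (.inr i)))).1 = s • (T d f).1 ∧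
      form e f = d * form (E ℤ (.inl i)) (E ℤ (.inr i)) ∧ (i = i₀ → e = e₀ ∧ f = f₀) ∧
      (i ≠ i₀ → ∃ c, (φ (T 1 (E ℤ (.inl i₀) + E ℤ (.inl i)))).1 = s • (T d c).1 ∧
        form c f₀ = d * form (E ℤ (.inl i₀)) (E ℤ (.inr i₀)) ∧
        form c f = d * form (E ℤ (.inl i)) (E ℤ (.inr i))) := by
    intro i
    by_cases hi : i = i₀
    · subst hi
      exact ⟨e₀, f₀, he₀, hf₀, hef₀, fun _ => ⟨rfl, rfl⟩, fun h => absurd rfl h⟩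
    · have h1 : form (E ℤ (.inl i₀) + E ℤ (.inl i)) (E ℤ (.inr i₀)) =
          form (E ℤ (.inl i₀)) (E ℤ (.inr i₀)) := by
        rw [form_add_left, form_E_E (.inl i), if_neg (by simpa using Ne.symm hi), add_zero]
      have h2 : form (E ℤ (.inl i₀) + E ℤ (.inl i)) (E ℤ (.inr i)) =
          form (E ℤ (.inl i)) (E ℤ (.inr i)) := by
        rw [form_add_left, form_E_E (.inl i₀), if_neg (by simpa using hi), zero_add]
      obtain ⟨c, hc, hcf⟩ := exists_map_form_eq hs hd hφ
        (primitive_of_form_sq (y := E ℤ (.inr i)) (by rw [h2, sq])) hf₀ (by rw [h1, sq])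
      have h3 : form (E ℤ (.inr i)) (E ℤ (.inl i₀) + E ℤ (.inl i)) =
          -form (E ℤ (.inl i)) (E ℤ (.inr i)) := by rw [form_swap, h2]
      obtain ⟨f, hf, hfc⟩ := exists_map_form_eq hs hd hφ (primitive_E (.inr i)) hc
        (by rw [h3, neg_mul_neg, sq])
      obtain ⟨e, he, hef⟩ := exists_map_form_eq hs hd hφ (primitive_E (.inl i)) hf (sq i)
      refine ⟨e, f, he, hf, hef, fun h => absurd h hi, fun _ => ⟨c, hc, by rw [hcf, h1], ?_⟩⟩
      rw [form_swap, hfc, h3, mul_neg, neg_neg]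
  choose e f he hf hef h0 hc using key
  set b : l ⊕ l → l ⊕ l → ℤ := Sum.elim e f with hb
  have hbm : ∀ p, (φ (T 1 (E ℤ p))).1 = s • (T d (b p)).1 := by
    rintro (i | i)
    · exact he i
    · exact hf i
  set g : Matrix (l ⊕ l) (l ⊕ l) ℤ := Matrix.of fun r p => b p r with hg
  have hgb : ∀ p, g *ᵥ E ℤ p = b p := by
    intro p; rw [mulVec_E]; rfl
  have hsim : ∀ x y, form (g *ᵥ x) (g *ᵥ y) = d * form x y := by
    refine form_mulVec_of_E fun p q => ?_
    rw [hgb, hgb]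
    by_cases hq : q = p.swap
    · subst hq
      rcases p with i | i
      · exact hef i
      · change form (f i) (e i) = d * form (E ℤ (.inr i)) (E ℤ (.inl i))
        rw [form_swap, hef, form_swap (E ℤ (.inr i)), mul_neg]
    · have : form (E ℤ p) (E ℤ q) = 0 := by rw [form_E_E, if_neg hq]
      rw [this, form_eq_zero_of_map hs hd (hbm p) (hbm q) this, mul_zero]
  refine ⟨g, hsim, fun p => by rw [hgb, hbm], fun i hi => ?_⟩
  obtain ⟨c, hcm, hc1, hc2⟩ := hc i hi
  -- Both sides have the same pairings with the vectors `g *ᵥ E ℤ p`; since `g` is invertible and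
  -- the form nondegenerate, they agree.
  have hce : c = g *ᵥ (E ℤ (.inl i₀) + E ℤ (.inl i)) := by
    obtain ⟨h, -, hgh⟩ := exists_inverse_of_similitude hd hsim
    rw [← sub_eq_zero]
    set z := c - g *ᵥ (E ℤ (.inl i₀) + E ℤ (.inl i)) with hz
    have hzp : ∀ p, form z (g *ᵥ E ℤ p) = 0 := by
      intro p
      rw [hz, form_sub_left, hsim, hgb, sub_eq_zero]
      by_cases h1 : p = .inr i₀
      · subst h1
        rw [form_add_left, form_E_E (.inl i), if_neg (by simpa using Ne.symm hi), add_zero, ← hc1]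
        change form c (f i₀) = _
        rw [(h0 i₀ rfl).2]
      by_cases h2 : p = .inr i
      · subst h2
        rw [form_add_left, form_E_E (.inl i₀), if_neg (by simpa using hi), zero_add, ← hc2]
        rfl
      · have : form (E ℤ (.inl i₀) + E ℤ (.inl i)) (E ℤ p) = 0 := by
          rw [form_add_left, form_E_E, form_E_E, if_neg (by exact h1), if_neg (by exact h2), add_zero]
        rw [this, form_eq_zero_of_map hs hd hcm (hbm p) this, mul_zero]
    have hgz : ∀ y, form (h *ᵥ z) y = 0 := by
      have : h *ᵥ z = 0 := by
        refine eq_of_form fun p => ?_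
        have h3 := hsim (h *ᵥ z) (E ℤ p)
        rw [mulVec_mulVec, hgh, one_mulVec, hzp] at h3
        rw [form_zero_left]
        have hd0 : d ≠ 0 := by rintro rfl; simp at hd
        exact (mul_eq_zero.1 h3.symm).resolve_left hd0
      intro y; rw [this, form_zero_left]
    have h4 := eq_zero_of_form hgz
    calc z = g *ᵥ (h *ᵥ z) := by rw [mulVec_mulVec, hgh, one_mulVec]
      _ = 0 := by rw [h4, mulVec_zero]
  rw [← hce, hcm]

end Image

/-! ### From finitely many transvections to the whole group -/

section Good

variable {φ : MulAut (symplecticGroup l ℤ)} {s d : ℤ} {g : Matrix (l ⊕ l) (l ⊕ l) ℤ}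

/-- `φ` acts on the transvection in `v` as conjugation by `g`, up to the sign `s`. -/
def Good (φ : MulAut (symplecticGroup l ℤ)) (s : ℤ) (g : Matrix (l ⊕ l) (l ⊕ l) ℤ)
    (v : l ⊕ l → ℤ) : Prop :=
  (φ (T 1 v)).1 * g = s • (g * (T 1 v).1)

theorem Good.inv_T {v : l ⊕ l → ℤ} (hs : s * s = 1) (hv : Good φ s g v) :
    (φ (T (-1) v)).1 * g = s • (g * (T (-1) v).1) := by
  have h1 : (φ (T (-1) v)).1 * (φ (T 1 v)).1 = 1 := by
    rw [← Submonoid.coe_mul, ← map_mul, T_mul, neg_add_cancel, T_zero, map_one]; rfl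
  have h2 : (T 1 v).1 * (T (-1) v).1 = 1 := by
    rw [← Submonoid.coe_mul, T_mul, add_neg_cancel, T_zero]; rfl
  calc (φ (T (-1) v)).1 * g = (φ (T (-1) v)).1 * (g * (T 1 v).1) * (T (-1) v).1 := by
        rw [Matrix.mul_assoc, Matrix.mul_assoc, h2, Matrix.mul_one]
    _ = (φ (T (-1) v)).1 * (s • (φ (T 1 v)).1 * g) * (T (-1) v).1 := by
        congr 2
        rw [smul_mul_assoc, hv, smul_smul, hs, one_smul]
    _ = s • (g * (T (-1) v).1) := by
        rw [smul_mul_assoc, mul_smul_comm, ← Matrix.mul_assoc, h1, Matrix.one_mul, smul_mul_assoc]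

/-- Conjugating `T 1 v` by `x` uses `x` and its inverse once each, so the sign attached to `x`
cancels. -/
theorem Good.mulVec {v : l ⊕ l → ℤ} (hs : s * s = 1)
    (hv : Good φ s g v) {x : symplecticGroup l ℤ} (hx : (φ x).1 * g = s • (g * x.1)) :
    Good φ s g (x.1 *ᵥ v) := by
  have h1 : (T 1 (x.1 *ᵥ v)).1 * x.1 = x.1 * (T 1 v).1 := by
    rw [← Submonoid.coe_mul, ← mul_T, Submonoid.coe_mul]
  have h2 : (φ (T 1 (x.1 *ᵥ v))).1 * (φ x).1 = (φ x).1 * (φ (T 1 v)).1 := by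
    rw [← Submonoid.coe_mul, ← map_mul, ← mul_T, map_mul, Submonoid.coe_mul]
  have hx1 : x.1 * (x⁻¹).1 = 1 := by rw [← Submonoid.coe_mul, mul_inv_cancel]; rfl
  have hx2 : (φ x).1 * (φ x⁻¹).1 = 1 := by
    rw [← Submonoid.coe_mul, ← map_mul, mul_inv_cancel, map_one]; rfl
  unfold Good at hv ⊢
  have h3 : (φ (T 1 (x.1 *ᵥ v))).1 * (g * x.1) = s • (g * (T 1 (x.1 *ᵥ v)).1) * x.1 := by
    calc (φ (T 1 (x.1 *ᵥ v))).1 * (g * x.1)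
        = s • ((φ (T 1 (x.1 *ᵥ v))).1 * ((φ x).1 * g)) := by
          rw [hx, mul_smul_comm, smul_smul, hs, one_smul]
      _ = s • ((φ x).1 * ((φ (T 1 v)).1 * g)) := by
          rw [← Matrix.mul_assoc, h2, Matrix.mul_assoc]
      _ = (φ x).1 * g * (T 1 v).1 := by
          rw [hv, mul_smul_comm, smul_smul, hs, one_smul, Matrix.mul_assoc]
      _ = s • (g * (T 1 (x.1 *ᵥ v)).1) * x.1 := by
          rw [hx, smul_mul_assoc, smul_mul_assoc, Matrix.mul_assoc, Matrix.mul_assoc, h1]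
  calc _ = (φ (T 1 (x.1 *ᵥ v))).1 * (g * x.1) * (x⁻¹).1 := by
        rw [Matrix.mul_assoc, Matrix.mul_assoc, hx1, Matrix.mul_one]
    _ = _ := by rw [h3, Matrix.mul_assoc, hx1, Matrix.mul_one]

variable (hs : s * s = 1)

include hs

theorem Good.T_mulVec {u v : l ⊕ l → ℤ} (hu : Good φ s g u) (hv : Good φ s g v) {c : ℤ}
    (hc : c = 1 ∨ c = -1) : Good φ s g ((T c u).1 *ᵥ v) := by
  rcases hc with rfl | rfl
  · exact hv.mulVec hs hu
  · exact hv.mulVec hs (hu.inv_T hs)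

theorem Good.of_T_mulVec {u v : l ⊕ l → ℤ} (hu : Good φ s g u) {c : ℤ}
    (hc : c = 1 ∨ c = -1) (hv : Good φ s g ((T c u).1 *ᵥ v)) : Good φ s g v := by
  have h1 : Good φ s g ((T (-c) u).1 *ᵥ ((T c u).1 *ᵥ v)) :=
    Good.T_mulVec hs hu hv (by rcases hc with rfl | rfl <;> simp)
  rwa [← mul_mulVec, T_mul, neg_add_cancel, T_zero, one_mulVec'] at h1

theorem Good.add {u v : l ⊕ l → ℤ} (hu : Good φ s g u) (hv : Good φ s g v)
    (huv : form u v * form u v = 1) : Good φ s g (v + u) := by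
  have := Good.T_mulVec hs hu hv (c := form u v)
    (Int.eq_one_or_neg_one_of_mul_eq_one huv)
  rwa [Symplectic.T_mulVec, huv, one_smul] at this

theorem Good.sub {u v : l ⊕ l → ℤ} (hu : Good φ s g u) (hv : Good φ s g v)
    (huv : form u v * form u v = 1) : Good φ s g (v - u) := by
  have := Good.T_mulVec hs hu hv (c := -form u v)
    (by rcases Int.eq_one_or_neg_one_of_mul_eq_one huv with h | h <;> simp [h])
  rwa [Symplectic.T_mulVec, neg_mul, huv, neg_one_smul, ← sub_eq_add_neg] at this

/-- Passing through `x + E p + E p.swap` makes each of the two moves an addition or subtraction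
along a pairing of `±1`. -/
theorem Good.rotate (hE : ∀ p, Good φ s g (E ℤ p)) {x : l ⊕ l → ℤ} {p : l ⊕ l}
    (h1 : form (E ℤ p) x = 0) (h2 : form (E ℤ p.swap) x = 0) (hx : Good φ s g (x + E ℤ p)) :
    Good φ s g (x + E ℤ p.swap) := by
  have hp := sgn_mul_self p
  have hp' := sgn_mul_self p.swap
  have h3 := Good.add hs (hE p.swap) hx (by
    rw [form_add_right, h2, form_E_E, if_pos (by simp)]; simpa using hp')
  have h4 := Good.sub hs (hE p) h3 (by
    rw [form_add_right, form_add_right, h1, form_E_E, form_E_E, if_pos rfl,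
      if_neg (by cases p <;> simp)]
    simpa using hp)
  rwa [show x + E ℤ p + E ℤ p.swap - E ℤ p = x + E ℤ p.swap by abel] at h4

/-- Rotations inside planes extend the given sums to every sum with one term in plane `i₀`; any
other sum is reached through that plane. -/
theorem Good.E_add_E (hE : ∀ p, Good φ s g (E ℤ p)) {i₀ : l}
    (h0 : ∀ i, i ≠ i₀ → Good φ s g (E ℤ (.inl i₀) + E ℤ (.inl i))) {q r : l ⊕ l}
    (h1 : q ≠ r) (h2 : q ≠ r.swap) : Good φ s g (E ℤ q + E ℤ r) := by
  have S1 : ∀ q : l ⊕ l, q ≠ .inl i₀ → q ≠ .inr i₀ →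
      Good φ s g (E ℤ (.inl i₀) + E ℤ q) := by
    rintro (i | i) hq hq'
    · exact h0 i (by simpa using hq)
    · have hi : i ≠ i₀ := by simpa using hq'
      refine Good.rotate hs hE (p := .inl i) ?_ ?_ (h0 i hi) <;>
        simp [form_E_E, Ne.symm hi]
  have S2 : ∀ q : l ⊕ l, q ≠ .inl i₀ → q ≠ .inr i₀ →
      Good φ s g (E ℤ (.inr i₀) + E ℤ q) := by
    intro q hq hq'
    rw [add_comm]
    refine Good.rotate hs hE (p := .inl i₀) ?_ ?_ ?_
    · rw [form_E_E, if_neg (by simpa using hq')]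
    · rw [form_E_E, if_neg (by simpa using hq)]
    · rw [add_comm]; exact S1 q hq hq'
  by_cases a1 : q = .inl i₀
  · subst a1
    exact S1 r h1.symm (by rintro rfl; simp at h2)
  by_cases a2 : q = .inr i₀
  · subst a2
    exact S2 r (by rintro rfl; simp at h2) h1.symm
  by_cases a3 : r = .inl i₀
  · subst a3; rw [add_comm]; exact S1 q a1 a2
  by_cases a4 : r = .inr i₀
  · subst a4; rw [add_comm]; exact S2 q a1 a2
  have b1 : q.swap ≠ .inl i₀ := fun h => a2 (by simpa using congrArg Sum.swap h)
  have b2 : q.swap ≠ .inr i₀ := fun h => a1 (by simpa using congrArg Sum.swap h)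
  have b3 : r ≠ q.swap := fun h => h2 (by rw [h, Sum.swap_swap])
  have b5 : q ≠ q.swap := by cases q <;> simp
  have b6 : Sum.swap (Sum.inl i₀ : l ⊕ l) = .inr i₀ := rfl
  have b7 : Sum.swap (Sum.inr i₀ : l ⊕ l) = .inl i₀ := rfl
  have hq := sgn_mul_self q
  -- Two sums with terms in plane `i₀` are added, then both auxiliary vectors of that plane are
  -- removed, each time along a pairing of `±1`. Removing the second introduces `-E q.swap`, which
  -- the last move cancels.
  have c1 := Good.add hs (S1 q a1 a2) (S2 r a3 a4) (by
    simp [form_add_left, form_add_right, form_E_E, b6, a4, b2.symm, b3, sgn])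
  have c2 := Good.sub hs (hE (.inl i₀)) c1 (by
    simp [form_add_right, form_E_E, a4, a2, sgn])
  have e2 : E ℤ (.inr i₀) + E ℤ r + (E ℤ (.inl i₀) + E ℤ q) - E ℤ (.inl i₀) =
      E ℤ (.inr i₀) + E ℤ r + E ℤ q := by abel
  rw [e2] at c2
  have hq' := sgn_mul_self q.swap
  have c3 := Good.sub hs (S2 q.swap b1 b2) c2 (by
    simpa [form_add_left, form_add_right, form_E_E, b7, a3, a1, Ne.symm a2, h1.symm] using hq')
  have e3 : E ℤ (.inr i₀) + E ℤ r + E ℤ q - (E ℤ (.inr i₀) + E ℤ q.swap) =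
      E ℤ q + E ℤ r - E ℤ q.swap := by abel
  rw [e3] at c3
  have c4 := Good.add hs (hE q.swap) c3 (by
    simpa [form_add_right, form_sub_right, form_E_E, form_self, h1.symm] using hq')
  rwa [sub_add_cancel] at c4

theorem Good.of_primitive (hE : ∀ p, Good φ s g (E ℤ p)) {i₀ : l}
    (h0 : ∀ i, i ≠ i₀ → Good φ s g (E ℤ (.inl i₀) + E ℤ (.inl i))) {v : l ⊕ l → ℤ}
    (hv : Primitive v) : Good φ s g v := by
  refine euclid (Good φ s g) (fun p v c hc => Good.of_T_mulVec hs (hE p) hc)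
    (fun p q v h1 h2 c hc => Good.of_T_mulVec hs ?_ hc) (fun p => ⟨hE p, ?_⟩) hv
  · exact Good.E_add_E hs hE h0 h1.symm (fun h => h2 (by rw [h, Sum.swap_swap]))
  · have := hE p
    rwa [Good, ← T_neg] at this

/-- If all transvections are mapped as under conjugation by a similitude `g`, then so is every
element, up to a sign. -/
theorem mul_eq_smul_of_good {h : Matrix (l ⊕ l) (l ⊕ l) ℤ} {d : ℤ} (hd : d * d = 1)
    (hg : ∀ x y, form (g *ᵥ x) (g *ᵥ y) = d * form x y) (hhg : h * g = 1) (hgh : g * h = 1)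
    (hgood : ∀ v, Primitive v → Good φ s g v) (i₀ : l) (x : symplecticGroup l ℤ) :
    ∃ ε : ℤ, ε * ε = 1 ∧ (φ x).1 * g = ε • (g * x.1) := by
  have hh : ∀ x y, form (h *ᵥ x) (h *ᵥ y) = d * form x y := by
    intro x y
    have := hg (h *ᵥ x) (h *ᵥ y)
    simp only [mulVec_mulVec, hgh, one_mulVec] at this
    rw [this, ← mul_assoc, hd, one_mul]
  -- `y = g⁻¹ φ(x) g x⁻¹` measures the failure of `φ` to be conjugation by `g`. It commutes with all
  -- `T 1 v`, `v` primitive, since the two signs `s` met on the way cancel.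
  let y : symplecticGroup l ℤ := ⟨h * (φ x).1 * g * (x⁻¹).1, mem_iff_form.2 fun a b => by
    simp only [← mulVec_mulVec]
    rw [hh, form_mulVec, hg, form_mulVec, ← mul_assoc, hd, one_mul]⟩
  have hx1 : x.1 * (x⁻¹).1 = 1 := by rw [← Submonoid.coe_mul, mul_inv_cancel]; rfl
  have hx2 : (x⁻¹).1 * x.1 = 1 := by rw [← Submonoid.coe_mul, inv_mul_cancel]; rfl
  have hy : g * (y.1 * x.1) = (φ x).1 * g := by
    change g * (h * (φ x).1 * g * (x⁻¹).1 * x.1) = _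
    rw [Matrix.mul_assoc _ _ x.1, hx2, Matrix.mul_one, ← Matrix.mul_assoc, ← Matrix.mul_assoc, hgh,
      Matrix.one_mul]
  have hfix : ∀ v, Primitive v → y.1 *ᵥ v = v ∨ y.1 *ᵥ v = -v := by
    intro v hv
    refine eq_or_eq_neg_of_T_eq one_ne_zero ?_
    rw [← conj_T, mul_inv_eq_iff_eq_mul]
    refine Subtype.ext ?_
    set u := (x⁻¹).1 *ᵥ v with hu
    have hu' : Good φ s g u := hgood u (hv.mulVec _)
    have hv' : Good φ s g v := hgood v hv
    have h1 : (x⁻¹).1 * (T 1 v).1 = (T 1 u).1 * (x⁻¹).1 := by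
      rw [← Submonoid.coe_mul, mul_T, Submonoid.coe_mul]
    have h2 : (φ x).1 * (φ (T 1 u)).1 = (φ (T 1 v)).1 * (φ x).1 := by
      rw [← Submonoid.coe_mul, ← map_mul, mul_T, map_mul, Submonoid.coe_mul, hu, mulVec_inv_mulVec]
    have h3 : h * (φ (T 1 v)).1 = s • ((T 1 v).1 * h) := by
      calc h * (φ (T 1 v)).1 = h * ((φ (T 1 v)).1 * g) * h := by
            rw [Matrix.mul_assoc, Matrix.mul_assoc, hgh, Matrix.mul_one]
        _ = _ := by
            rw [hv', mul_smul_comm, ← Matrix.mul_assoc, hhg, Matrix.one_mul, smul_mul_assoc]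
    change h * (φ x).1 * g * (x⁻¹).1 * (T 1 v).1 = (T 1 v).1 * (h * (φ x).1 * g * (x⁻¹).1)
    calc h * (φ x).1 * g * (x⁻¹).1 * (T 1 v).1
        = h * (φ x).1 * (g * (T 1 u).1) * (x⁻¹).1 := by
          rw [Matrix.mul_assoc _ (x⁻¹).1, h1]; simp only [Matrix.mul_assoc]
      _ = h * (φ x).1 * (s • ((φ (T 1 u)).1 * g)) * (x⁻¹).1 := by
          rw [hu', smul_smul, hs, one_smul]
      _ = s • (h * ((φ x).1 * (φ (T 1 u)).1) * g * (x⁻¹).1) := by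
          rw [mul_smul_comm, smul_mul_assoc]; simp only [Matrix.mul_assoc]
      _ = s • (h * (φ (T 1 v)).1 * ((φ x).1 * g * (x⁻¹).1)) := by
          rw [h2]; simp only [Matrix.mul_assoc]
      _ = (T 1 v).1 * (h * (φ x).1 * g * (x⁻¹).1) := by
          rw [h3, smul_mul_assoc, smul_smul, hs, one_smul]; simp only [Matrix.mul_assoc]
  set p : l ⊕ l := .inl i₀ with hp
  obtain ⟨ε, m, hε, hym⟩ := exists_T_of_forall_orthogonal (primitive_E p) y fun u hu _ => hfix u hu
  -- A nontrivial transvection in `E p` would not send `E p.swap` to `± E p.swap`.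
  have hm : m = 0 := by
    have h1 := hfix (E ℤ p.swap) (primitive_E _)
    rw [hym, smul_mulVec, Symplectic.T_mulVec, form_E_E, if_pos rfl] at h1
    have hε0 : ε ≠ 0 := by rintro rfl; simp at hε
    rcases h1 with h1 | h1 <;> have := congrFun h1 p <;> simpa [E, hp, sgn, hε0] using this
  refine ⟨ε, hε, ?_⟩
  rw [← hy, hym, hm, T_zero, smul_mul_assoc, mul_smul_comm]
  congr 2
  exact Matrix.one_mul _

/-- An automorphism respecting transvections is, up to signs, conjugation by a similitude. -/
theorem exists_conj (hd : d * d = 1) (hφ : MapsTransvections φ s d) (i₀ : l) :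
    ∃ g h : Matrix (l ⊕ l) (l ⊕ l) ℤ, h * g = 1 ∧ g * h = 1 ∧
      (∀ x y, form (g *ᵥ x) (g *ᵥ y) = d * form x y) ∧
      ∀ x : symplecticGroup l ℤ, ∃ ε : ℤ, ε * ε = 1 ∧ (φ x).1 * g = ε • (g * x.1) := by
  obtain ⟨g, hg, h1, h2⟩ := exists_similitude hs hd hφ i₀
  obtain ⟨h, hhg, hgh⟩ := exists_inverse_of_similitude hd hg
  have good : ∀ v, (φ (T 1 v)).1 = s • (T d (g *ᵥ v)).1 → Good φ s g v := by
    intro v hv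
    rw [Good, hv, smul_mul_assoc, similitude_mul_T hd hg, mul_one]
  exact ⟨g, h, hhg, hgh, hg, mul_eq_smul_of_good hs hd hg hhg hgh (fun v hv =>
    Good.of_primitive hs (fun p => good _ (h1 p)) (fun i hi => good _ (h2 i hi)) hv) i₀⟩

end Good

/-! ### The trace invariant of Reidemeister classes -/

/-- A family of similitudes whose squares have pairwise distinct traces. -/
def traceFamily (i₀ : l) (d m : ℤ) : Matrix (l ⊕ l) (l ⊕ l) ℤ :=
  fromBlocks (diagonal fun i => if i = i₀ then m else 1) (diagonal fun i => if i = i₀ then -d else 0)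
    (diagonal fun i => if i = i₀ then 1 else 0) (diagonal fun i => if i = i₀ then 0 else d)

/-- Plane `i₀` carries the block with rows `(m, -d)` and `(1, 0)`, every other plane `diag(1, d)`;
all have determinant `d`. -/
theorem form_traceFamily (i₀ : l) (d m : ℤ) (x y : l ⊕ l → ℤ) :
    form (traceFamily i₀ d m *ᵥ x) (traceFamily i₀ d m *ᵥ y) = d * form x y := by
  rw [form_eq_sum, form_eq_sum, Finset.mul_sum]
  refine Finset.sum_congr rfl fun i _ => ?_
  by_cases hi : i = i₀ <;> simp [traceFamily, fromBlocks_mulVec, mulVec_diagonal, hi] <;> ring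

theorem trace_traceFamily_sq (i₀ : l) {d : ℤ} (hd : d * d = 1) (m : ℤ) :
    (traceFamily i₀ d m * traceFamily i₀ d m).trace = m * m + (2 * Fintype.card l - 2 - 2 * d) := by
  rw [traceFamily, fromBlocks_multiply, trace, Fintype.sum_sum_type]
  simp only [diagonal_mul_diagonal, diagonal_add, diag_apply, fromBlocks_apply₁₁,
    fromBlocks_apply₂₂, diagonal_apply_eq]
  rw [← Finset.sum_add_distrib]
  have : ∀ i, (if i = i₀ then m else 1) * (if i = i₀ then m else 1) +
      (if i = i₀ then -d else 0) * (if i = i₀ then 1 else 0) +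
      ((if i = i₀ then 1 else 0) * (if i = i₀ then -d else 0) +
      (if i = i₀ then 0 else d) * (if i = i₀ then 0 else d)) =
      (if i = i₀ then m * m - 2 * d - 2 else 0) + 2 := by
    intro i
    by_cases hi : i = i₀ <;> simp [hi]
    · ring
    · linarith
  rw [Finset.sum_congr rfl fun i _ => this i, Finset.sum_add_distrib]
  simp
  ring

/-- Right multiplication by `g` turns twisted conjugacy into ordinary conjugacy up to sign. The
trace of the square ignores the sign, and on the family it is `m²` plus a constant. -/
theorem reidemeisterNumber_eq_top_of_mapsTransvections {φ : MulAut (symplecticGroup l ℤ)} {s d : ℤ}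
    (hs : s * s = 1) (hd : d * d = 1) (hφ : MapsTransvections φ s d) (i₀ : l) :
    reidemeisterNumber φ = ⊤ := by
  obtain ⟨g, h, hhg, hgh, hg, hconj⟩ := exists_conj hs hd hφ i₀
  have hK : ∀ m, traceFamily i₀ d m * h ∈ symplecticGroup l ℤ := fun m => mem_iff_form.2 fun x y => by
    rw [← mulVec_mulVec, ← mulVec_mulVec, form_traceFamily, ← hg, mulVec_mulVec, mulVec_mulVec, hgh,
      one_mulVec, one_mulVec]
  rw [reidemeisterNumber, ENat.card_eq_top]
  refine Infinite.of_injective (fun m : ℕ => Quotient.mk (twistedConjSetoid φ)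
    ⟨traceFamily i₀ d m * h, hK m⟩) fun m m' hmm => ?_
  obtain ⟨z, hz⟩ := Quotient.exact hmm
  have hz1 := congrArg Subtype.val hz
  simp only [Submonoid.coe_mul] at hz1
  obtain ⟨ε, hε, hφz⟩ := hconj z⁻¹
  have h1 : traceFamily i₀ d m' = ε • (z.1 * traceFamily i₀ d m * (z⁻¹).1) := by
    calc traceFamily i₀ d m' = traceFamily i₀ d m' * h * g := by
          rw [Matrix.mul_assoc, hhg, Matrix.mul_one]
      _ = z.1 * (traceFamily i₀ d m * h) * ((φ z⁻¹).1 * g) := by rw [hz1, Matrix.mul_assoc]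
      _ = ε • (z.1 * (traceFamily i₀ d m * (h * g)) * (z⁻¹).1) := by
          rw [hφz, mul_smul_comm]; simp only [Matrix.mul_assoc]
      _ = _ := by rw [hhg, Matrix.mul_one]
  have hzz : (z⁻¹).1 * z.1 = 1 := by rw [← Submonoid.coe_mul, inv_mul_cancel]; rfl
  have h2 : traceFamily i₀ d m' * traceFamily i₀ d m' =
      z.1 * (traceFamily i₀ d m * traceFamily i₀ d m) * (z⁻¹).1 := by
    rw [h1, smul_mul_smul_comm, hε, one_smul]
    calc _ = z.1 * traceFamily i₀ d m * ((z⁻¹).1 * z.1) * traceFamily i₀ d m * (z⁻¹).1 := by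
          simp only [Matrix.mul_assoc]
      _ = _ := by rw [hzz, Matrix.mul_one]; simp only [Matrix.mul_assoc]
  have h3 := congrArg trace h2
  rw [trace_mul_comm (_ * _) (z⁻¹).1, ← Matrix.mul_assoc, hzz, Matrix.one_mul, trace_traceFamily_sq i₀ hd,
    trace_traceFamily_sq i₀ hd, add_left_inj] at h3
  have h4 : m' * m' = m * m := by exact_mod_cast h3
  exact (Nat.mul_self_inj.1 h4).symm

/-- It suffices to map one power of a transvection to a power of a transvection. -/
theorem reidemeisterNumber_eq_top_of_map_T {φ : MulAut (symplecticGroup l ℤ)} {v w : l ⊕ l → ℤ}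
    {k c : ℤ} (hv : Primitive v) (hw : Primitive w) (hk : k ≠ 0) (hc : c ≠ 0)
    (h : φ (T k v) = T c w) (i₀ : l) : reidemeisterNumber φ = ⊤ := by
  obtain ⟨s, d, hs, hd, hsd⟩ := map_T_eq_sign hv hw hk hc h
  refine reidemeisterNumber_eq_top_of_mapsTransvections hs hd (fun u hu => ?_) i₀
  -- All transvections in primitive vectors are conjugate, so the same `s` and `d` serve for every
  -- one.
  obtain ⟨x, rfl⟩ := exists_mulVec_eq hv hu
  refine ⟨(φ x).1 *ᵥ w, ?_⟩
  rw [← conj_T, ← conj_T, map_mul, map_mul, map_inv, Submonoid.coe_mul, Submonoid.coe_mul, hsd,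
    mul_smul_comm, smul_mul_assoc, Submonoid.coe_mul, Submonoid.coe_mul]

end Similitude

/-! ### Rank one: generators and two-by-two identities -/

section RankOne

/-- The first standard basis vector of the plane. -/
abbrev e₁ : Fin 1 ⊕ Fin 1 → ℤ := E ℤ (.inl 0)

/-- The second standard basis vector of the plane. -/
abbrev f₁ : Fin 1 ⊕ Fin 1 → ℤ := E ℤ (.inr 0)

theorem form_e_f : form e₁ f₁ = -1 := by simp [form_E_E, sgn]

theorem form_f_e : form f₁ e₁ = 1 := by simp [form_E_E, sgn]

theorem forall_index {P : Fin 1 ⊕ Fin 1 → Prop} : (∀ p, P p) ↔ P (.inl 0) ∧ P (.inr 0) := by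
  simp [Sum.forall, Fin.forall_fin_one]

theorem group_ext_plane {x y : symplecticGroup (Fin 1) ℤ} (h1 : x.1 *ᵥ e₁ = y.1 *ᵥ e₁)
    (h2 : x.1 *ᵥ f₁ = y.1 *ᵥ f₁) : x = y :=
  Subtype.ext (ext_mulVec_E (forall_index.2 ⟨h1, h2⟩))

theorem matrix_ext_plane {X Y : Matrix (Fin 1 ⊕ Fin 1) (Fin 1 ⊕ Fin 1) ℤ}
    (h : (X (.inl 0) (.inl 0) = Y (.inl 0) (.inl 0) ∧ X (.inl 0) (.inr 0) = Y (.inl 0) (.inr 0)) ∧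
      (X (.inr 0) (.inl 0) = Y (.inr 0) (.inl 0) ∧ X (.inr 0) (.inr 0) = Y (.inr 0) (.inr 0))) :
    X = Y := by
  ext p q
  revert q
  rw [forall_index]
  revert p
  rw [forall_index]
  exact h

/-- The order four generator. -/
def rotFour : symplecticGroup (Fin 1) ℤ := T 1 e₁ * T 1 f₁ * T 1 e₁

/-- The order six generator. -/
def rotSix : symplecticGroup (Fin 1) ℤ := T 1 e₁ * T 1 f₁

theorem rotFour_e : rotFour.1 *ᵥ e₁ = f₁ := by
  simp only [rotFour, mul_mulVec]
  simp [T_mulVec, form_add_right, form_self, form_e_f, form_f_e]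

theorem rotFour_f : rotFour.1 *ᵥ f₁ = -e₁ := by
  simp only [rotFour, mul_mulVec]
  simp [T_mulVec, form_add_right, form_neg_right, form_self, form_e_f, form_f_e]

theorem rotSix_e : rotSix.1 *ᵥ e₁ = f₁ := by
  simp only [rotSix, mul_mulVec]
  simp [T_mulVec, form_add_right, form_self, form_e_f, form_f_e]

theorem rotSix_f : rotSix.1 *ᵥ f₁ = f₁ - e₁ := by
  simp only [rotSix, mul_mulVec]
  simp [T_mulVec, form_self, form_e_f, sub_eq_add_neg]

theorem rotFour_sq_mulVec (x : Fin 1 ⊕ Fin 1 → ℤ) : (rotFour * rotFour).1 *ᵥ x = -x := by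
  have : (rotFour * rotFour).1 = (-1 : Matrix (Fin 1 ⊕ Fin 1) (Fin 1 ⊕ Fin 1) ℤ) := by
    refine ext_mulVec_E (forall_index.2 ⟨?_, ?_⟩) <;>
      simp only [mul_mulVec, rotFour_e, rotFour_f, mulVec_neg, neg_mulVec, one_mulVec]
  rw [this, neg_mulVec, one_mulVec]

theorem rotSix_cube : rotSix * rotSix * rotSix = rotFour * rotFour := by
  refine group_ext_plane ?_ ?_ <;> rw [rotFour_sq_mulVec] <;> simp only [mul_mulVec] <;>
    simp [rotSix_e, rotSix_f, mulVec_sub, mulVec_neg]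

/-- The Euclidean algorithm brings `x e₁` back to `e₁`, and an element fixing `e₁` is a power of `T
1 e₁`. -/
theorem closure_transvections_plane : Subgroup.closure {T 1 e₁, T 1 f₁} = ⊤ := by
  set H := Subgroup.closure {T 1 e₁, T 1 f₁} with hH
  have he : T 1 e₁ ∈ H := Subgroup.subset_closure (by simp)
  have hf : T 1 f₁ ∈ H := Subgroup.subset_closure (by simp)
  have hE : ∀ p : Fin 1 ⊕ Fin 1, T 1 (E ℤ p) ∈ H := forall_index.2 ⟨he, hf⟩
  have ha : rotFour ∈ H := H.mul_mem (H.mul_mem he hf) he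
  have haa : rotFour * rotFour ∈ H := H.mul_mem ha ha
  have orbit : ∀ v, Primitive v → ∃ h ∈ H, h.1 *ᵥ v = e₁ := by
    intro v hv
    refine euclid (fun v => ∃ h ∈ H, h.1 *ᵥ v = e₁) ?_ ?_ ?_ hv
    · rintro p v c hc ⟨h, hh, hhv⟩
      refine ⟨h * T c (E ℤ p), H.mul_mem hh ?_, by rw [mul_mulVec, hhv]⟩
      rcases hc with rfl | rfl
      · exact hE p
      · rw [← T_inv]; exact H.inv_mem (hE p)
    -- Mixed moves need two different planes and cannot occur here.
    · rintro (p | p) (q | q) v h1 h2 <;> exfalso <;>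
        first
          | exact h1 (congrArg _ (Subsingleton.elim _ _))
          | exact h2 (congrArg _ (Subsingleton.elim _ _))
    · refine forall_index.2 ⟨⟨⟨1, H.one_mem, one_mulVec' _⟩, ⟨_, haa, ?_⟩⟩,
        ⟨⟨_, H.mul_mem haa ha, ?_⟩, ⟨_, ha, ?_⟩⟩⟩
      · rw [rotFour_sq_mulVec, neg_neg]
      · rw [mul_mulVec, rotFour_f, rotFour_sq_mulVec, neg_neg]
      · rw [mulVec_neg, rotFour_f, neg_neg]
  rw [eq_top_iff]
  intro x _
  obtain ⟨h, hh, hhx⟩ := orbit (x.1 *ᵥ e₁) ((primitive_E _).mulVec x)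
  rw [← mul_mulVec] at hhx
  have hy : h * x = T (-((h * x).1 *ᵥ f₁) (.inl 0)) e₁ := by
    refine group_ext_plane ?_ ?_
    · rw [T_mulVec, form_self, mul_zero, zero_smul, add_zero, hhx]
    · have h1 := form_mulVec (h * x) e₁ f₁
      rw [hhx, form_e_f, form_E_left] at h1
      rw [T_mulVec, form_e_f]
      refine funext (forall_index.2 ⟨?_, ?_⟩)
      · simp [E]
      · have h2 : ((h * x).1 *ᵥ f₁) (.inr 0) = 1 := by
          simpa only [sgn, Int.cast_neg, Int.cast_one, Sum.swap_inl, neg_mul, one_mul,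
            neg_inj] using h1
        rw [h2]
        simp [E]
  have hx : x = h⁻¹ * T (-((h * x).1 *ᵥ f₁) (.inl 0)) e₁ := by rw [← hy, inv_mul_cancel_left]
  rw [hx]
  refine H.mul_mem (H.inv_mem hh) ?_
  have := T_zpow 1 e₁ (-((h * x).1 *ᵥ f₁) (.inl 0))
  rw [mul_one, Int.cast_id] at this
  rw [← this]
  exact H.zpow_mem he _

/-- Cayley–Hamilton; the determinant is `1` because the form is preserved. -/
theorem mul_self_plane (x : symplecticGroup (Fin 1) ℤ) : x.1 * x.1 = x.1.trace • x.1 - 1 := by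
  have h := form_mulVec x e₁ f₁
  rw [form_e_f, form_eq_sum] at h
  simp [E] at h
  refine matrix_ext_plane ⟨⟨?_, ?_⟩, ?_, ?_⟩ <;>
    simp [-zsmul_eq_mul, -zsmul_one, Matrix.mul_apply, Fintype.sum_sum_type, trace]
  · linear_combination h
  · ring
  · ring
  · linear_combination h

/-- The polarized Cayley–Hamilton identity. -/
theorem anticommutator_plane (A B : Matrix (Fin 1 ⊕ Fin 1) (Fin 1 ⊕ Fin 1) ℤ) :
    A * B + B * A = A.trace • B + B.trace • A + ((A * B).trace - A.trace * B.trace) • 1 := by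
  refine matrix_ext_plane ⟨⟨?_, ?_⟩, ?_, ?_⟩ <;>
    simp [-zsmul_eq_mul, -zsmul_one, Matrix.mul_apply, Fintype.sum_sum_type, trace] <;> ring

theorem eq_scalar_of_smul_eq {X : Matrix (Fin 1 ⊕ Fin 1) (Fin 1 ⊕ Fin 1) ℤ} {a b : ℤ} (ha : a ≠ 0)
    (h : a • X = b • 1) : X = X (.inl 0) (.inl 0) • 1 := by
  have h1 := congrFun (congrFun h (.inl 0)) (.inr 0)
  have h2 := congrFun (congrFun h (.inr 0)) (.inl 0)
  have h3 := congrFun (congrFun h (.inl 0)) (.inl 0)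
  have h4 := congrFun (congrFun h (.inr 0)) (.inr 0)
  simp [-zsmul_eq_mul, ha] at h1 h2 h3 h4
  refine matrix_ext_plane ⟨⟨?_, ?_⟩, ?_, ?_⟩ <;> simp [-zsmul_eq_mul, h1, h2]
  exact mul_left_cancel₀ ha (h4.trans h3.symm)

/-- Since `-1` is the only involution, every automorphism fixes it. -/
theorem eq_neg_one_of_sq {y : symplecticGroup (Fin 1) ℤ} (h : y * y = 1) (hy : y ≠ 1) :
    y.1 = -1 := by
  have h1 : y.1 * y.1 = 1 := congrArg Subtype.val h
  have h2 := mul_self_plane y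
  rw [h1] at h2
  have h3 : y.1.trace • y.1 = (2 : ℤ) • (1 : Matrix (Fin 1 ⊕ Fin 1) (Fin 1 ⊕ Fin 1) ℤ) := by
    rw [two_smul]; exact (eq_sub_iff_add_eq.1 h2).symm
  have h4 : y.1.trace ≠ 0 := by
    intro h0
    rw [h0, zero_smul] at h3
    have := congrFun (congrFun h3 (.inl 0)) (.inl 0)
    simp at this
  have h5 := eq_scalar_of_smul_eq h4 h3
  set c := y.1 (.inl 0) (.inl 0)
  have hc : c * c = 1 := by
    rw [h5, smul_mul_smul_comm, mul_one] at h1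
    have := congrFun (congrFun h1 (.inl 0)) (.inl 0)
    simpa using this
  rcases Int.eq_one_or_neg_one_of_mul_eq_one hc with hc | hc
  · exact absurd (Subtype.ext (by rw [h5, hc, one_smul]; rfl)) hy
  · rw [h5, hc, neg_one_smul]

/-! ### Rank one: traces of the images of the generators -/

section Trace

variable (φ : MulAut (symplecticGroup (Fin 1) ℤ))

theorem map_rotFour_sq : (φ (rotFour * rotFour)).1 = -1 := by
  have hne : rotFour * rotFour ≠ 1 := by
    intro h
    have := congrArg (fun x : symplecticGroup (Fin 1) ℤ => (x.1 *ᵥ e₁) (.inl 0)) h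
    simp only [rotFour_sq_mulVec, one_mulVec'] at this
    simp [E] at this
  refine eq_neg_one_of_sq ?_ ?_
  · rw [← map_mul]
    have : rotFour * rotFour * (rotFour * rotFour) = 1 :=
      group_ext fun x => by rw [mul_mulVec, rotFour_sq_mulVec, rotFour_sq_mulVec, neg_neg,
        one_mulVec']
    rw [this, map_one]
  · intro h
    exact hne (φ.injective (by rw [h, map_one]))

theorem map_rotFour_mul_self : (φ rotFour).1 * (φ rotFour).1 = -1 := by
  rw [← map_rotFour_sq φ, map_mul]; rfl

theorem trace_map_rotFour : (φ rotFour).1.trace = 0 := by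
  have h1 := mul_self_plane (φ rotFour)
  rw [map_rotFour_mul_self, eq_comm, sub_eq_iff_eq_add, neg_add_cancel] at h1
  rcases smul_eq_zero.1 h1 with h | h
  · exact h
  · have := map_rotFour_mul_self φ
    rw [h] at this
    have := congrFun (congrFun this (.inl 0)) (.inl 0)
    simp at this

/-- From `u² = τ u - 1` and `u³ = -1` follows `(τ² - 1) u = τ - 1`. Either `τ² = 1`, and then `τ =
1`, or `u` is a scalar with cube `-1`; the latter would give `rotSix` and `rotFour * rotFour` the
same image. -/
theorem trace_map_rotSix : (φ rotSix).1.trace = 1 := by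
  set u := (φ rotSix).1 with hu
  set τ := u.trace with hτ
  have h1 : u * u = τ • u - 1 := mul_self_plane (φ rotSix)
  have h2 : u * u * u = -1 := by
    rw [← map_rotFour_sq φ, ← rotSix_cube, map_mul, map_mul]; rfl
  have h3 : (τ * τ - 1) • u = (τ - 1) • (1 : Matrix (Fin 1 ⊕ Fin 1) (Fin 1 ⊕ Fin 1) ℤ) := by
    rw [h1, sub_mul, smul_mul_assoc, h1, one_mul, smul_sub, smul_smul] at h2
    rw [sub_smul, sub_smul, one_smul, one_smul, ← sub_eq_zero]
    rw [← sub_eq_zero] at h2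
    rw [← h2]; abel
  by_cases h4 : τ * τ - 1 = 0
  · rw [h4, zero_smul] at h3
    have := congrFun (congrFun h3 (.inl 0)) (.inl 0)
    simp at this
    omega
  · exfalso
    have h5 := eq_scalar_of_smul_eq h4 h3
    set c := u (.inl 0) (.inl 0)
    have hc : c * c * c = -1 := by
      rw [h5, smul_mul_smul_comm, smul_mul_smul_comm, mul_one, mul_one] at h2
      have := congrFun (congrFun h2 (.inl 0)) (.inl 0)
      simpa [-zsmul_eq_mul] using this
    have hc1 : c = -1 := by
      have : (c + 1) * (c * c - c + 1) = 0 := by linear_combination hc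
      rcases mul_eq_zero.1 this with h | h
      · linarith
      · nlinarith [sq_nonneg (2 * c - 1)]
    have h6 : φ rotSix = φ (rotFour * rotFour) := by
      refine Subtype.ext ?_
      rw [map_rotFour_sq φ, ← hu, h5, hc1, neg_one_smul]
    have h7 := congrArg (fun x : symplecticGroup (Fin 1) ℤ => (x.1 *ᵥ e₁) (.inl 0)) (φ.injective h6)
    simp only [rotFour_sq_mulVec, rotSix_e] at h7
    simp [E] at h7

/-- The elements of the order spanned by `1`, `s`, `u` and `s * u`. -/
def InOrder (s u X : Matrix (Fin 1 ⊕ Fin 1) (Fin 1 ⊕ Fin 1) ℤ) : Prop :=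
  ∃ a b c d : ℤ, X = a • 1 + b • s + c • u + d • (s * u)

/-- The relations rewrite right multiplication by `s` and by `u` in the four spanning elements,
which suffices because these are words in `s` and `u`. -/
theorem inOrder_mul {s u X Y : Matrix (Fin 1 ⊕ Fin 1) (Fin 1 ⊕ Fin 1) ℤ} {θ : ℤ}
    (hs : s * s = -1) (hu : u * u = u - 1) (hus : u * s = s + θ • 1 - s * u)
    (hX : InOrder s u X) (hY : InOrder s u Y) : InOrder s u (X * Y) := by
  have right_s : ∀ X, InOrder s u X → InOrder s u (X * s) := by
    rintro X ⟨a, b, c, d, rfl⟩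
    refine ⟨c * θ - b - d, a + c + d * θ, d, -c, ?_⟩
    have h1 : s * u * s = s * (s + θ • 1 - s * u) := by rw [Matrix.mul_assoc, hus]
    have h2 : s * (s * u) = -u := by rw [← Matrix.mul_assoc, hs, neg_one_mul]
    simp only [add_mul, smul_mul_assoc, h1, hus, hs, mul_add, mul_sub, h2, mul_smul_comm, mul_one,
      one_mul]
    module
  have right_u : ∀ X, InOrder s u X → InOrder s u (X * u) := by
    rintro X ⟨a, b, c, d, rfl⟩
    refine ⟨-c, -d, a + c, b + d, ?_⟩
    have h1 : s * u * u = s * u - s := by rw [Matrix.mul_assoc, hu, mul_sub, mul_one]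
    simp only [add_mul, smul_mul_assoc, h1, hu, one_mul]
    module
  have add : ∀ X Y, InOrder s u X → InOrder s u Y → InOrder s u (X + Y) := by
    rintro X Y ⟨a, b, c, d, rfl⟩ ⟨a', b', c', d', rfl⟩
    exact ⟨a + a', b + b', c + c', d + d', by module⟩
  have smul : ∀ (k : ℤ) X, InOrder s u X → InOrder s u (k • X) := by
    rintro k X ⟨a, b, c, d, rfl⟩
    exact ⟨k * a, k * b, k * c, k * d, by module⟩
  obtain ⟨a, b, c, d, rfl⟩ := hY
  simp only [mul_add, mul_smul_comm, mul_one, ← Matrix.mul_assoc]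
  exact add _ _ (add _ _ (add _ _ (smul _ _ hX) (smul _ _ (right_s _ hX)))
    (smul _ _ (right_u _ hX))) (smul _ _ (right_u _ (right_s _ hX)))

theorem map_rotSix_mul_self : (φ rotSix).1 * (φ rotSix).1 = (φ rotSix).1 - 1 := by
  rw [mul_self_plane, trace_map_rotSix, one_smul]

theorem map_rotSix_mul_map_rotFour : (φ rotSix).1 * (φ rotFour).1 = (φ rotFour).1 +
    ((φ rotFour).1 * (φ rotSix).1).trace • 1 - (φ rotFour).1 * (φ rotSix).1 := by
  have := anticommutator_plane (φ rotFour).1 (φ rotSix).1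
  rw [trace_map_rotFour, trace_map_rotSix, zero_smul, zero_add, one_smul, zero_mul, sub_zero] at this
  rw [← this, add_sub_cancel_left]

/-- The order is closed under inverses because `x⁻¹ = tr(x) - x`, and both generating transvections
are words in `rotFour` and `rotSix`. -/
theorem inOrder_map (x : symplecticGroup (Fin 1) ℤ) :
    InOrder (φ rotFour).1 (φ rotSix).1 (φ x).1 := by
  have hx : x ∈ Subgroup.closure {T 1 e₁, T 1 f₁} := by
    rw [closure_transvections_plane]; exact Subgroup.mem_top x
  have hmul : ∀ x y, InOrder (φ rotFour).1 (φ rotSix).1 (φ x).1 →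
      InOrder (φ rotFour).1 (φ rotSix).1 (φ y).1 →
      InOrder (φ rotFour).1 (φ rotSix).1 (φ (x * y)).1 := by
    intro x y h1 h2
    rw [map_mul, Submonoid.coe_mul]
    exact inOrder_mul (map_rotFour_mul_self φ) (map_rotSix_mul_self φ)
      (map_rotSix_mul_map_rotFour φ) h1 h2
  have hinv : ∀ x, InOrder (φ rotFour).1 (φ rotSix).1 (φ x).1 →
      InOrder (φ rotFour).1 (φ rotSix).1 (φ x⁻¹).1 := by
    intro x h
    have h1 : (φ x).1 * (φ x⁻¹).1 = 1 := by
      rw [← Submonoid.coe_mul, ← map_mul, mul_inv_cancel, map_one]; rfl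
    have h2 : (φ x⁻¹).1 = (φ x).1.trace • 1 - (φ x).1 := by
      calc (φ x⁻¹).1 = ((φ x).1.trace • (φ x).1 - (φ x).1 * (φ x).1) * (φ x⁻¹).1 := by
            rw [mul_self_plane, sub_sub_cancel, one_mul]
        _ = _ := by rw [sub_mul, smul_mul_assoc, h1, Matrix.mul_assoc, h1, mul_one]
    obtain ⟨a, b, c, d, h3⟩ := h
    rw [h2]
    refine ⟨(φ x).1.trace - a, -b, -c, -d, ?_⟩
    set t := (φ x).1.trace
    rw [h3]
    module
  have ha : InOrder (φ rotFour).1 (φ rotSix).1 (φ rotFour).1 := ⟨0, 1, 0, 0, by simp⟩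
  have hb : InOrder (φ rotFour).1 (φ rotSix).1 (φ rotSix).1 := ⟨0, 0, 1, 0, by simp⟩
  have ht : InOrder (φ rotFour).1 (φ rotSix).1 (φ (T 1 e₁)).1 := by
    have : T 1 e₁ = rotSix⁻¹ * rotFour := by
      rw [rotFour, rotSix, inv_mul_cancel_left]
    rw [this]
    exact hmul _ _ (hinv _ hb) ha
  refine Subgroup.closure_induction (p := fun x _ => InOrder (φ rotFour).1 (φ rotSix).1 (φ x).1)
    ?_ ⟨1, 0, 0, 0, by rw [map_one]; simp⟩ (fun x y _ _ => hmul x y) (fun x _ => hinv x) hx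
  rintro x (rfl | rfl)
  · exact ht
  · have : T 1 f₁ = (T 1 e₁)⁻¹ * rotSix := by rw [rotSix, inv_mul_cancel_left]
    rw [this]
    exact hmul _ _ (hinv _ ht) hb

theorem inOrder_coe (x : symplecticGroup (Fin 1) ℤ) :
    InOrder (φ rotFour).1 (φ rotSix).1 x.1 := by
  simpa using inOrder_map φ (φ.symm x)

/-- The commutator is orthogonal to `1`, `s` and `u` under the trace pairing; its pairing with `s *
u` is `θ² - 3`. -/
theorem trace_commutator_mul {s u X : Matrix (Fin 1 ⊕ Fin 1) (Fin 1 ⊕ Fin 1) ℤ} {θ : ℤ}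
    (hs : s * s = -1) (hu : u * u = u - 1) (hus : u * s = s + θ • 1 - s * u)
    (htu : u.trace = 1) (htsu : (s * u).trace = θ)
    (hX : InOrder s u X) : θ * θ - 3 ∣ ((s * u - u * s) * X).trace := by
  obtain ⟨a, b, c, d, rfl⟩ := hX
  have h1 : (s * u - u * s).trace = 0 := by rw [trace_sub, trace_mul_comm, sub_self]
  have h2 : ((s * u - u * s) * s).trace = 0 := by
    rw [sub_mul, trace_sub, trace_mul_comm, ← Matrix.mul_assoc, hs, Matrix.mul_assoc, hs]
    simp
  have h3 : ((s * u - u * s) * u).trace = 0 := by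
    rw [sub_mul, trace_sub, trace_mul_comm (u * s) u, Matrix.mul_assoc, ← Matrix.mul_assoc u,
      trace_mul_comm, sub_self]
  have h4 : ((s * u - u * s) * (s * u)).trace = θ * θ - 3 := by
    have e1 : s * u * (s * u) = θ • (s * u) - 1 := by
      calc s * u * (s * u) = s * (u * s) * u := by simp only [Matrix.mul_assoc]
        _ = s * s * u + θ • (s * u) - s * s * (u * u) := by
          rw [hus]
          simp only [mul_sub, sub_mul, mul_add, add_mul, mul_smul_comm, smul_mul_assoc, mul_one,
            Matrix.mul_assoc]
        _ = _ := by rw [hs, hu]; simp only [neg_mul, one_mul, mul_sub, mul_one]; abel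
    have e2 : u * s * (s * u) = -(u - 1) := by
      rw [Matrix.mul_assoc, ← Matrix.mul_assoc s, hs, neg_one_mul, mul_neg, hu]
    rw [sub_mul, trace_sub, e1, e2, trace_sub, trace_smul, htsu, trace_neg, trace_sub, htu]
    simp
    ring
  simp only [mul_add, mul_smul_comm, mul_one, trace_add, trace_smul, h1, h2, h3, h4]
  simp

theorem E_apply {l : Type*} [DecidableEq l] {R : Type*} [CommRing R] (p q : l ⊕ l) :
    E R p q = if q = p then 1 else 0 := by
  rw [E, Pi.single_apply]

theorem T_apply (c : ℤ) (v : Fin 1 ⊕ Fin 1 → ℤ) (p q : Fin 1 ⊕ Fin 1) :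
    (T c v).1 p q = E ℤ q p + c * form v (E ℤ q) * v p := by
  have := congrFun (T_mulVec c v (E ℤ q)) p
  rwa [mulVec_E] at this

/-- Every entry of `κ` is an integral combination of the traces against `1`, `T 1 e₁`, `T 1 f₁` and
the product of these two transvections. -/
theorem dvd_of_forall_dvd_trace {d : ℤ} {κ : Matrix (Fin 1 ⊕ Fin 1) (Fin 1 ⊕ Fin 1) ℤ}
    (h : ∀ x : symplecticGroup (Fin 1) ℤ, d ∣ (κ * x.1).trace) : ∃ κ', κ = d • κ' := by
  have h1 := h 1
  have h2 := h (T 1 e₁)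
  have h3 := h (T 1 f₁)
  have h4 := h (T 1 e₁ * T 1 f₁)
  rw [Submonoid.coe_mul] at h4
  simp [trace, Matrix.mul_apply, Fintype.sum_sum_type, T_apply, form_E_E, sgn, E_apply] at h1 h2 h3 h4
  obtain ⟨k₁, h1⟩ := h1
  obtain ⟨k₂, h2⟩ := h2
  obtain ⟨k₃, h3⟩ := h3
  obtain ⟨k₄, h4⟩ := h4
  have hA : d ∣ κ (.inl 0) (.inl 0) := ⟨k₂ + k₃ - k₄ - k₁, by linear_combination h2 + h3 - h4 - h1⟩
  have hB : d ∣ κ (.inl 0) (.inr 0) := ⟨k₃ - k₁, by linear_combination h3 - h1⟩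
  have hC : d ∣ κ (.inr 0) (.inl 0) := ⟨k₁ - k₂, by linear_combination h1 - h2⟩
  have hD : d ∣ κ (.inr 0) (.inr 0) :=
    ⟨k₁ - (k₂ + k₃ - k₄ - k₁), by linear_combination h1 - (h2 + h3 - h4 - h1)⟩
  have hall : ∀ p, ∀ q, d ∣ κ p q :=
    forall_index.2 ⟨forall_index.2 ⟨hA, hB⟩, forall_index.2 ⟨hC, hD⟩⟩
  choose κ' hκ' using hall
  exact ⟨of κ', by ext p q; simp [-zsmul_eq_mul, hκ' p q]⟩

/-- By bilinearity only commutators among `s`, `u`, `s * u` matter, and each is a multiple of `s * u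
- u * s` by `±1`, `s` or `-u`. -/
theorem commutator_of_inOrder {s u X Y : Matrix (Fin 1 ⊕ Fin 1) (Fin 1 ⊕ Fin 1) ℤ}
    (hX : InOrder s u X) (hY : InOrder s u Y) : ∃ a b c : ℤ, X * Y - Y * X =
      a • (s * u - u * s) + b • (s * (s * u - u * s)) + c • ((s * u - u * s) * u) := by
  obtain ⟨a, b, c, d, rfl⟩ := hX
  obtain ⟨a', b', c', d', rfl⟩ := hY
  refine ⟨b * c' - c * b', b * d' - d * b', -(c * d' - d * c'), ?_⟩
  simp only [mul_add, add_mul, mul_sub, sub_mul, mul_smul_comm, smul_mul_assoc, mul_one, one_mul,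
    Matrix.mul_assoc]
  module

/-- The order contains all group elements, so `θ² - 3` divides first the commutator of the two
generators, then that of `T 1 e₁` and `T 1 f₁`. The latter has an entry `-1`, so `θ²` is `4` or `2`,
and `2` is not a square. -/
theorem trace_map_rotFour_mul_rotSix :
    ((φ rotFour).1 * (φ rotSix).1).trace * ((φ rotFour).1 * (φ rotSix).1).trace = 4 := by
  set θ := ((φ rotFour).1 * (φ rotSix).1).trace with hθ
  obtain ⟨κ, hκ⟩ := dvd_of_forall_dvd_trace (d := θ * θ - 3)
    (κ := (φ rotFour).1 * (φ rotSix).1 - (φ rotSix).1 * (φ rotFour).1) fun x =>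
      trace_commutator_mul (map_rotFour_mul_self φ) (map_rotSix_mul_self φ)
        (map_rotSix_mul_map_rotFour φ) (trace_map_rotSix φ) rfl (inOrder_coe φ x)
  obtain ⟨a, b, c, h⟩ := commutator_of_inOrder (inOrder_coe φ (T 1 e₁)) (inOrder_coe φ (T 1 f₁))
  rw [hκ] at h
  have hdvd : θ * θ - 3 ∣ 1 := by
    have h1 := congrFun (congrFun h (.inl 0)) (.inl 0)
    have h2 : ((T 1 e₁).1 * (T 1 f₁).1 - (T 1 f₁).1 * (T 1 e₁).1) (.inl 0) (.inl 0) = -1 := by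
      simp [Matrix.mul_apply, Fintype.sum_sum_type, T_apply, form_E_E, sgn, E_apply]
    rw [h2] at h1
    simp only [mul_smul_comm, smul_mul_assoc, Matrix.add_apply, Matrix.smul_apply, smul_eq_mul] at h1
    refine ⟨-(a * κ (.inl 0) (.inl 0) + b * ((φ rotFour).1 * κ) (.inl 0) (.inl 0) +
      c * (κ * (φ rotSix).1) (.inl 0) (.inl 0)), ?_⟩
    linear_combination -h1
  rcases Int.isUnit_iff.1 (isUnit_of_dvd_one hdvd) with h1 | h1
  · linarith
  · exfalso
    have h2 : θ * θ = 2 := by linarith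
    rcases le_or_gt 2 |θ| with h3 | h3
    · nlinarith [abs_mul_abs_self θ]
    · have := abs_lt.1 h3
      obtain ⟨h4, h5⟩ := this
      interval_cases θ <;> omega

/-- As `T 1 e₁ = rotSix⁻¹ * rotFour`, its image is `(1 - u) s`, of trace `-θ`. -/
theorem trace_map_T : (φ (T 1 e₁)).1.trace * (φ (T 1 e₁)).1.trace = 4 := by
  have h1 : (φ rotSix).1 * (φ (T 1 e₁)).1 = (φ rotFour).1 := by
    rw [← Submonoid.coe_mul, ← map_mul]; rfl
  have h2 : (φ (T 1 e₁)).1 = (φ rotFour).1 - (φ rotSix).1 * (φ rotFour).1 := by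
    rw [← h1, ← Matrix.mul_assoc, map_rotSix_mul_self, sub_mul, one_mul, sub_sub_cancel]
  rw [h2, trace_sub, trace_map_rotFour, trace_mul_comm, zero_sub, neg_mul_neg,
    trace_map_rotFour_mul_rotSix]

/-- The image of `T 1 e₁` has trace `±2` and may be minus a unipotent matrix; squaring removes the
sign. -/
theorem exists_map_T_eq_plane : ∃ (c : ℤ) (w : Fin 1 ⊕ Fin 1 → ℤ), c ≠ 0 ∧ Primitive w ∧
    φ (T 2 e₁) = T c w := by
  set x := φ (T 1 e₁) with hx
  set τ := x.1.trace with hτ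
  have hg : φ (T 2 e₁) = x * x := by rw [hx, ← map_mul, T_mul, one_add_one_eq_two]
  have hg1 : φ (T 2 e₁) ≠ 1 := by
    intro h
    have h1 : T 2 e₁ = 1 := φ.injective (by rw [h, map_one])
    have := congrArg (fun g : symplecticGroup (Fin 1) ℤ => (g.1 *ᵥ f₁) (.inl 0)) h1
    simp only [T_mulVec, one_mulVec', form_e_f] at this
    simp [E] at this
  set g := φ (T 2 e₁) with hgdef
  set N := g.1 - 1 with hN
  have hN1 : N = τ • x.1 - (2 : ℤ) • 1 := by
    rw [hN, hg, Submonoid.coe_mul, mul_self_plane, two_smul]; abel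
  have hNN : N * N = 0 := by
    rw [hN1]
    simp only [sub_mul, mul_sub, smul_mul_assoc, mul_smul_comm, mul_one, one_mul, mul_self_plane x,
      ← hτ]
    have h4 : τ * τ = 4 := trace_map_T φ
    have : τ • τ • (τ • x.1 - 1) = (4 : ℤ) • (τ • x.1 - 1) := by rw [smul_smul, h4]
    rw [smul_sub τ, this]
    module
  have hNx : ∀ y, N *ᵥ y = g.1 *ᵥ y - y := fun y => by rw [hN, sub_mulVec, one_mulVec]
  obtain ⟨y₀, hy₀⟩ : ∃ y, N *ᵥ y ≠ 0 := by
    by_contra h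
    push Not at h
    exact hg1 (group_ext fun y => by rw [one_mulVec', ← sub_eq_zero, ← hNx, h])
  set u := N *ᵥ y₀ with hu
  have hgu : g.1 *ᵥ u = u := by
    rw [← sub_eq_zero, ← hNx, hu, mulVec_mulVec, hNN, zero_mulVec]
  refine exists_eq_T hg1 (u := u) fun y => ?_
  have h1 : form (g.1 *ᵥ y - y) u = 0 := by
    have := form_mulVec g y u
    rw [hgu] at this
    rw [form_sub_left, this, sub_self]
  set z := g.1 *ᵥ y - y with hz
  -- In a plane, orthogonality for the alternating form is proportionality.
  have h2 : z (.inr 0) * u (.inl 0) = z (.inl 0) * u (.inr 0) := by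
    rw [form_eq_sum] at h1
    simp at h1
    linarith
  by_cases hu0 : u (.inl 0) = 0
  · have hu1 : u (.inr 0) ≠ 0 := fun h => hy₀ (funext (forall_index.2 ⟨hu0, h⟩))
    refine ⟨u (.inr 0), z (.inr 0), hu1, funext (forall_index.2 ⟨?_, ?_⟩)⟩ <;>
      simp only [Pi.smul_apply, smul_eq_mul] <;> linarith
  · refine ⟨u (.inl 0), z (.inl 0), hu0, funext (forall_index.2 ⟨?_, ?_⟩)⟩ <;>
      simp only [Pi.smul_apply, smul_eq_mul] <;> linarith

theorem reidemeisterNumber_plane : reidemeisterNumber φ = ⊤ := by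
  obtain ⟨c, w, hc, hw, h⟩ := exists_map_T_eq_plane φ
  exact reidemeisterNumber_eq_top_of_map_T (primitive_E _) hw two_ne_zero hc h 0

end Trace

end RankOne

/-! ### Spectra of transvections in complex representations -/

section Representation

variable {l : Type*} [Fintype l] [DecidableEq l]

theorem rep_inv_apply {V : Type*} [AddCommGroup V] [Module ℂ V]
    (ρ : symplecticGroup l ℤ →* Module.End ℂ V) (g : symplecticGroup l ℤ) (x : V) : ρ g⁻¹ (ρ g x) = x := by
  rw [← Module.End.mul_apply, ← map_mul, inv_mul_cancel, map_one, Module.End.one_apply]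

theorem rep_eigenvalue_ne_zero {V : Type*} [AddCommGroup V] [Module ℂ V]
    (ρ : symplecticGroup l ℤ →* Module.End ℂ V) {g : symplecticGroup l ℤ} {x : V} {μ : ℂ} (hx : x ≠ 0)
    (h : ρ g x = μ • x) : μ ≠ 0 := by
  rintro rfl
  apply hx
  rw [← rep_inv_apply ρ g x, h, zero_smul, map_zero]

/-- Transvections in primitive vectors are conjugate, so they share their eigenvalues. -/
theorem hasEigenvalue_rep_T {V : Type*} [AddCommGroup V] [Module ℂ V]
    (ρ : symplecticGroup l ℤ →* Module.End ℂ V) {v w : l ⊕ l → ℤ} (hv : Primitive v) (hw : Primitive w)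
    {μ : ℂ} {x : V} (hx : x ≠ 0) (h : ρ (T 1 w) x = μ • x) : (ρ (T 1 v)).HasEigenvalue μ := by
  obtain ⟨g, rfl⟩ := exists_mulVec_eq hv hw
  refine Module.End.hasEigenvalue_of_hasEigenvector (x := ρ g⁻¹ x)
    (Module.End.hasEigenvector_iff.2 ⟨Module.End.mem_eigenspace_iff.2 ?_, fun h0 => hx ?_⟩)
  · have h1 : T 1 v * g⁻¹ = g⁻¹ * T 1 (g.1 *ᵥ v) := by
      rw [← conj_T, mul_assoc, inv_mul_cancel_left]
    rw [← Module.End.mul_apply, ← map_mul, h1, map_mul, Module.End.mul_apply, h, map_smul]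
  · have := rep_inv_apply ρ g⁻¹ x
    rwa [h0, map_zero, eq_comm] at this

end Representation

/-! ### Rank at least two: powers of transvections act unipotently -/

section Unipotent

variable {V : Type*} [AddCommGroup V] [Module ℂ V] [FiniteDimensional ℂ V]

theorem exists_eigenvector_of_mapsTo {A : Module.End ℂ V} {S : Submodule ℂ V} (hS : S ≠ ⊥)
    (hA : ∀ x ∈ S, A x ∈ S) : ∃ (μ : ℂ) (x : V), x ∈ S ∧ x ≠ 0 ∧ A x = μ • x := by
  have : Nontrivial S := Submodule.nontrivial_iff_ne_bot.2 hS
  obtain ⟨μ, hμ⟩ := Module.End.exists_eigenvalue (A.restrict hA)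
  obtain ⟨x, hx⟩ := hμ.exists_hasEigenvector
  refine ⟨μ, x, x.2, fun h => hx.2 (Subtype.ext h), ?_⟩
  simpa using congrArg Subtype.val hx.apply_eq_smul

theorem isNilpotent_of_hasEigenvalue {B : Module.End ℂ V}
    (h : ∀ (μ : ℂ) (x : V), x ≠ 0 → B x = μ • x → μ = 0) : IsNilpotent B := by
  have h1 := Module.End.iSup_maxGenEigenspace_eq_top B
  have h2 : ∀ μ, μ ≠ 0 → B.maxGenEigenspace μ = ⊥ := by
    intro μ hμ
    by_contra hne
    obtain ⟨ν, x, hx, hx0, hBx⟩ := exists_eigenvector_of_mapsTo hne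
      (Module.End.mapsTo_maxGenEigenspace_of_comm (Commute.refl B) μ)
    have hν := h ν x hx0 hBx
    rw [Module.End.mem_maxGenEigenspace] at hx
    obtain ⟨k, hk⟩ := hx
    have h3 : ∀ k : ℕ, ((B - μ • (1 : Module.End ℂ V)) ^ k) x = (-μ) ^ k • x := by
      intro k
      induction k with
      | zero => simp
      | succ k ih =>
        rw [pow_succ', Module.End.mul_apply, ih, map_smul, LinearMap.sub_apply, hBx, hν, pow_succ]
        simp [smul_smul]
    rw [h3] at hk
    exact hx0 ((smul_eq_zero.1 hk).resolve_left (pow_ne_zero _ (neg_ne_zero.2 hμ)))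
  have h3 : B.maxGenEigenspace 0 = ⊤ := by
    rw [eq_top_iff, ← h1]
    refine iSup_le fun μ => ?_
    by_cases hμ : μ = 0
    · rw [hμ]
    · rw [h2 μ hμ]; exact bot_le
  refine ⟨Module.finrank ℂ V, LinearMap.ext fun x => ?_⟩
  have hx : x ∈ B.maxGenEigenspace 0 := h3 ▸ Submodule.mem_top
  rw [Module.End.maxGenEigenspace_eq_genEigenspace_finrank, Module.End.mem_genEigenspace_nat] at hx
  simpa using hx

/-- A complex number is a root of unity as soon as `a * c ^ m * b ^ (m ^ 2)` takes only finitely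
many values. -/
theorem exists_pow_eq_one {a b c : ℂ} (ha : a ≠ 0) (hb : b ≠ 0) (hc : c ≠ 0) {S : Set ℂ}
    (hS : S.Finite) (h : ∀ m : ℕ, a * c ^ m * b ^ (m ^ 2) ∈ S) : ∃ k : ℕ, 0 < k ∧ b ^ k = 1 := by
  have : Finite S := hS
  -- Pigeonhole is applied to pairs of consecutive values: their ratio `c b^(2m+1)` no longer
  -- involves a square in the exponent.
  obtain ⟨m, m', hmm, heq⟩ := Finite.exists_ne_map_eq_of_infinite
    (fun m : ℕ => ((⟨_, h m⟩, ⟨_, h (m + 1)⟩) : S × S))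
  have h1 : a * c ^ m * b ^ (m ^ 2) = a * c ^ m' * b ^ (m' ^ 2) :=
    congrArg (fun z => (z.1 : ℂ)) heq
  have h2 : a * c ^ (m + 1) * b ^ ((m + 1) ^ 2) = a * c ^ (m' + 1) * b ^ ((m' + 1) ^ 2) :=
    congrArg (fun z => (z.2 : ℂ)) heq
  have h3 : b ^ (2 * m) = b ^ (2 * m') := by
    have e : ∀ m : ℕ, a * c ^ (m + 1) * b ^ ((m + 1) ^ 2) =
        (a * c ^ m * b ^ (m ^ 2)) * (c * b) * b ^ (2 * m) := fun m => by ring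
    rw [e, e, h1] at h2
    exact mul_left_cancel₀ (mul_ne_zero (mul_ne_zero (mul_ne_zero ha (pow_ne_zero _ hc))
      (pow_ne_zero _ hb)) (mul_ne_zero hc hb)) h2
  rcases lt_or_gt_of_ne hmm with hlt | hlt
  · refine ⟨2 * m' - 2 * m, by omega, ?_⟩
    exact mul_left_cancel₀ (pow_ne_zero (2 * m) hb) (by
      rw [← pow_add, mul_one, h3]; congr 1; omega)
  · refine ⟨2 * m - 2 * m', by omega, ?_⟩
    exact mul_left_cancel₀ (pow_ne_zero (2 * m') hb) (by
      rw [← pow_add, mul_one, ← h3]; congr 1; omega)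

variable {l : Type*} [Fintype l] [DecidableEq l]

/-- Transvections in orthogonal vectors commute and compose by adding the squares of their vectors.
The formula is the expansion of `(v + m u)²`, the third factor of its cross term being `(u + v)² -
u² - v²`. -/
theorem T_add_nsmul {u v : l ⊕ l → ℤ} (huv : form u v = 0) (m : ℕ) :
    T 1 (v + (m : ℤ) • u) =
      T 1 v * (T 1 (u + v) * T (-1) u * T (-1) v) ^ m * T 1 u ^ (m ^ 2) := by
  have hvu : form v u = 0 := by rw [form_swap, huv, neg_zero]
  have h1 : form (u + v) u = 0 := by rw [form_add_left, form_self, hvu, add_zero]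
  have h2 : form (u + v) v = 0 := by rw [form_add_left, form_self, huv, add_zero]
  have c1 : Commute (T 1 (u + v) * T (-1) u) (T (-1) v) :=
    (commute_T h2 _ _).mul_left (commute_T huv _ _)
  rw [c1.mul_pow, (commute_T h1 1 (-1)).mul_pow, T_pow, T_pow, T_pow, T_pow]
  refine group_ext fun x => ?_
  simp only [mul_mulVec, T_mulVec, form_add_left, form_add_right, form_smul_left, form_smul_right,
    form_self, huv, hvu]
  ext p
  simp only [Pi.add_apply, Pi.smul_apply, smul_eq_mul]
  push_cast
  ring

variable (ρ : symplecticGroup l ℤ →* Module.End ℂ V)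

/-- In rank at least two, the eigenvalues of transvections in a finite-dimensional representation
are roots of unity. -/
theorem eigenvalue_root_of_unity {i j : l} (hij : i ≠ j) {b : ℂ} {x : V} (hx : x ≠ 0)
    (h : ρ (T 1 (E ℤ (.inl i))) x = b • x) : ∃ k : ℕ, 0 < k ∧ b ^ k = 1 := by
  set u := E ℤ (Sum.inl i : l ⊕ l) with hu
  set v := E ℤ (Sum.inl j : l ⊕ l) with hv
  have huv : form u v = 0 := by simp [hu, hv, form_E_E]
  have hvu : form v u = 0 := by rw [form_swap, huv, neg_zero]
  set C := T 1 (u + v) * T (-1) u * T (-1) v with hC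
  have hCu : Commute C (T 1 u) :=
    ((commute_T (by rw [form_add_left, form_self, hvu, add_zero]) _ _).mul_left
      (commute_T (form_self u) _ _)).mul_left (commute_T hvu _ _)
  have hCv : Commute C (T 1 v) :=
    ((commute_T (by rw [form_add_left, form_self, huv, add_zero]) _ _).mul_left
      (commute_T huv _ _)).mul_left (commute_T (form_self v) _ _)
  have comm : ∀ {g h : symplecticGroup l ℤ}, Commute g h → ∀ {μ : ℂ},
      ∀ y ∈ (ρ g).eigenspace μ, ρ h y ∈ (ρ g).eigenspace μ := by
    intro g h hgh μ y hy
    rw [Module.End.mem_eigenspace_iff] at hy ⊢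
    rw [← Module.End.mul_apply, ← map_mul, hgh.eq, map_mul, Module.End.mul_apply, hy, map_smul]
  obtain ⟨c, y, hy, hy0, hyc⟩ := exists_eigenvector_of_mapsTo
    (S := (ρ (T 1 u)).eigenspace b) (A := ρ C)
    (fun h0 => hx (by
      have : x ∈ (ρ (T 1 u)).eigenspace b := Module.End.mem_eigenspace_iff.2 h
      rwa [h0, Submodule.mem_bot] at this)) (comm hCu.symm)
  obtain ⟨a, z, hz, hz0, hza⟩ := exists_eigenvector_of_mapsTo
    (S := (ρ (T 1 u)).eigenspace b ⊓ (ρ C).eigenspace c) (A := ρ (T 1 v))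
    (fun h0 => hy0 (by
      have : y ∈ (ρ (T 1 u)).eigenspace b ⊓ (ρ C).eigenspace c :=
        ⟨hy, Module.End.mem_eigenspace_iff.2 hyc⟩
      rwa [h0, Submodule.mem_bot] at this))
    (fun y hy => ⟨comm (commute_T huv _ _) y hy.1, comm hCv y hy.2⟩)
  have hzb := Module.End.mem_eigenspace_iff.1 hz.1
  have hzc := Module.End.mem_eigenspace_iff.1 hz.2
  have hpow : ∀ {A : Module.End ℂ V} {μ : ℂ}, A z = μ • z → ∀ m : ℕ, (A ^ m) z = μ ^ m • z := by
    intro A μ hA m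
    induction m with
    | zero => simp
    | succ m ih => rw [pow_succ', Module.End.mul_apply, ih, map_smul, hA, smul_smul, pow_succ]
  -- On the common eigenvector `z`, the transvection in `v + m u` acts by `a c^m b^(m²)`, an
  -- eigenvalue of `T 1 u` for every `m`.
  refine exists_pow_eq_one (rep_eigenvalue_ne_zero ρ hz0 hza) (rep_eigenvalue_ne_zero ρ hz0 hzb)
    (rep_eigenvalue_ne_zero ρ hz0 hzc) (Module.End.finite_hasEigenvalue (ρ (T 1 u))) fun m => ?_
  have hprim : Primitive (v + (m : ℤ) • u) := primitive_of_form_sq (y := E ℤ (.inr j)) (by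
    rw [form_add_left, form_smul_left, hu, hv, form_E_E, form_E_E]
    simp [hij.symm, sgn])
  refine hasEigenvalue_rep_T ρ (primitive_E _) hprim hz0 ?_
  rw [T_add_nsmul huv, map_mul, map_mul, map_pow, map_pow, Module.End.mul_apply,
    Module.End.mul_apply, hpow hzb, map_smul, hpow hzc, map_smul, map_smul, hza, smul_smul,
    smul_smul]
  congr 1
  ring

theorem exists_common_pow {S : Set ℂ} (hS : S.Finite)
    (h : ∀ b ∈ S, ∃ k : ℕ, 0 < k ∧ b ^ k = 1) : ∃ k : ℕ, 0 < k ∧ ∀ b ∈ S, b ^ k = 1 := by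
  choose! f hf hf1 using h
  refine ⟨∏ b ∈ hS.toFinset, f b, Finset.prod_pos fun b hb => hf b (hS.mem_toFinset.1 hb),
    fun b hb => ?_⟩
  obtain ⟨d, hd⟩ := Finset.dvd_prod_of_mem f (hS.mem_toFinset.2 hb)
  rw [hd, pow_mul, hf1 b hb, one_pow]

/-- In rank at least two, a common power of all transvections acts unipotently. -/
theorem exists_isNilpotent {i j : l} (hij : i ≠ j) :
    ∃ k : ℕ, 0 < k ∧ ∀ v : l ⊕ l → ℤ, Primitive v → IsNilpotent (ρ (T k v) - 1) := by
  obtain ⟨k, hk, hk1⟩ := exists_common_pow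
    (Module.End.finite_hasEigenvalue (ρ (T 1 (E ℤ (Sum.inl i))))) fun b hb => by
      obtain ⟨x, hx⟩ := Module.End.HasEigenvalue.exists_hasEigenvector hb
      exact eigenvalue_root_of_unity ρ hij hx.2 hx.apply_eq_smul
  refine ⟨k, hk, fun v hv => isNilpotent_of_hasEigenvalue fun μ x hx hμ => ?_⟩
  have hT : ρ (T k v) = ρ (T 1 v) ^ k := by rw [← map_pow, T_pow, mul_one]
  have hcomm : Commute (ρ (T k v) - 1) (ρ (T 1 v)) := by
    rw [hT]
    exact ((Commute.refl _).pow_left k).sub_left (Commute.one_left _)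
  -- An eigenvector of `ρ (T 1 v)` inside the `μ`-eigenspace gives `μ = b ^ k - 1 = 0`.
  obtain ⟨b, y, hy, hy0, hyb⟩ := exists_eigenvector_of_mapsTo (A := ρ (T 1 v))
    (S := (ρ (T k v) - 1).eigenspace μ)
    (fun h0 => hx (by
      have : x ∈ (ρ (T k v) - 1).eigenspace μ := Module.End.mem_eigenspace_iff.2 hμ
      rwa [h0, Submodule.mem_bot] at this))
    (fun y hy => by
      rw [Module.End.mem_eigenspace_iff] at hy ⊢
      rw [← Module.End.mul_apply, hcomm.eq, Module.End.mul_apply, hy, map_smul])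
  rw [Module.End.mem_eigenspace_iff] at hy
  have hb : b ^ k = 1 := hk1 b (hasEigenvalue_rep_T ρ (primitive_E _) hv hy0 hyb)
  have hpow : ∀ m : ℕ, (ρ (T 1 v) ^ m) y = b ^ m • y := by
    intro m
    induction m with
    | zero => simp
    | succ m ih => rw [pow_succ', Module.End.mul_apply, ih, map_smul, hyb, smul_smul, pow_succ]
  rw [LinearMap.sub_apply, hT, hpow, hb, one_smul, Module.End.one_apply, sub_self, eq_comm] at hy
  exact (smul_eq_zero.1 hy).resolve_right hy0

end Unipotent

/-! ### Simultaneous eigenspaces of commuting symplectic involutions -/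

section Weights

variable {l ι : Type*} [Fintype l] [DecidableEq l]

/-- Commuting involutions preserving the standard form. -/
structure IsInvolutionFamily (f : ι → Module.End ℂ (l ⊕ l → ℂ)) : Prop where
  sq : ∀ i x, f i (f i x) = x
  comm : ∀ i j, Commute (f i) (f j)
  form_apply : ∀ i x y, form (f i x) (f i y) = form x y

/-- The simultaneous eigenspaces of a family of endomorphisms. -/
def weightSpace (f : ι → Module.End ℂ (l ⊕ l → ℂ)) (χ : ι → ℂ) : Submodule ℂ (l ⊕ l → ℂ) :=
  ⨅ i, (f i).eigenspace (χ i)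

variable {f : ι → Module.End ℂ (l ⊕ l → ℂ)}

omit [Fintype l] [DecidableEq l] in
theorem mem_weightSpace {χ : ι → ℂ} {x : l ⊕ l → ℂ} :
    x ∈ weightSpace f χ ↔ ∀ i, f i x = χ i • x := by
  simp [weightSpace]

namespace IsInvolutionFamily

variable (hf : IsInvolutionFamily f)

include hf

/-- Involutions are semisimple, as `X² - 1` is squarefree; the decomposition into generalized
eigenspaces therefore applies. -/
theorem weightSpace_eq (χ : ι → ℂ) : weightSpace f χ = ⨅ i, (f i).maxGenEigenspace (χ i) := by
  refine iInf_congr fun i => ?_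
  have h : (f i).IsSemisimple := by
    refine Module.End.isSemisimple_of_squarefree_aeval_eq_zero
      (p := (Polynomial.X ^ 2 - 1 : Polynomial ℂ)) ?_ ?_
    · exact (Polynomial.X_pow_sub_one_separable_iff.2 (by norm_num)).squarefree
    · refine LinearMap.ext fun x => ?_
      simp [pow_two, hf.sq]
  exact (h.isFinitelySemisimple.maxGenEigenspace_eq_eigenspace _).symm

theorem iSup_weightSpace : ⨆ χ, weightSpace f χ = ⊤ := by
  simp only [hf.weightSpace_eq]
  exact Module.End.iSup_iInf_maxGenEigenspace_eq_top_of_iSup_maxGenEigenspace_eq_top_of_commute f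
    (fun i j _ => hf.comm i j) fun i => Module.End.iSup_maxGenEigenspace_eq_top _

theorem iSupIndep_weightSpace : iSupIndep (weightSpace f) := by
  rw [show weightSpace f = fun χ => ⨅ i, (f i).maxGenEigenspace (χ i) from
    funext hf.weightSpace_eq]
  exact Module.End.independent_iInf_maxGenEigenspace_of_forall_mapsTo f fun i j μ =>
    Module.End.mapsTo_maxGenEigenspace_of_comm (hf.comm j i) μ

theorem le_of_forall_weightSpace {S : Submodule ℂ (l ⊕ l → ℂ)} (h : ∀ χ, weightSpace f χ ≤ S)
    (x : l ⊕ l → ℂ) : x ∈ S := by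
  have : (⊤ : Submodule ℂ (l ⊕ l → ℂ)) ≤ S := by
    rw [← hf.iSup_weightSpace]; exact iSup_le h
  exact this Submodule.mem_top

theorem weight_mul_self {χ : ι → ℂ} {x : l ⊕ l → ℂ} (hx : x ∈ weightSpace f χ) (hx0 : x ≠ 0)
    (i : ι) : χ i * χ i = 1 := by
  have h1 := hf.sq i x
  rw [mem_weightSpace.1 hx i, map_smul, mem_weightSpace.1 hx i, smul_smul] at h1
  have h2 : (χ i * χ i - 1) • x = 0 := by rw [sub_smul, h1, one_smul, sub_self]
  exact sub_eq_zero.1 ((smul_eq_zero.1 h2).resolve_right hx0)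

/-- Invariance of the form gives `χ i * χ' i = 1`, and the values of a weight are their own
inverses. -/
theorem eq_of_form_ne_zero {χ χ' : ι → ℂ} {x y : l ⊕ l → ℂ} (hx : x ∈ weightSpace f χ)
    (hy : y ∈ weightSpace f χ') (h : form x y ≠ 0) : χ = χ' := by
  ext i
  have hx0 : x ≠ 0 := by rintro rfl; exact h (form_zero_left y)
  have h1 := hf.form_apply i x y
  rw [mem_weightSpace.1 hx i, mem_weightSpace.1 hy i, form_smul_left, form_smul_right] at h1
  have h2 := hf.weight_mul_self hx hx0 i
  have h3 : χ i * χ' i = 1 := mul_right_cancel₀ h (by rw [one_mul, mul_assoc, h1])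
  have h4 : χ i ≠ 0 := by intro h0; simp [h0] at h2
  exact mul_left_cancel₀ h4 (h2.trans h3.symm)

/-- Distinct weight spaces are orthogonal, so the form is nondegenerate on each; an alternating form
vanishes on a line. -/
theorem two_le_finrank {χ : ι → ℂ} (h : weightSpace f χ ≠ ⊥) :
    2 ≤ Module.finrank ℂ (weightSpace f χ) := by
  obtain ⟨x, hx, hx0⟩ := Submodule.exists_mem_ne_zero_of_ne_bot h
  obtain ⟨y, hy, hxy⟩ : ∃ y ∈ weightSpace f χ, form x y ≠ 0 := by
    by_contra hcon
    push Not at hcon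
    let L : (l ⊕ l → ℂ) →ₗ[ℂ] ℂ :=
      { toFun := form x, map_add' := form_add_right x, map_smul' := fun c y => form_smul_right c x y }
    refine hx0 (eq_zero_of_form fun y => ?_)
    refine hf.le_of_forall_weightSpace (S := LinearMap.ker L) (fun χ' z hz => ?_) y
    change form x z = 0
    by_contra h0
    have := hf.eq_of_form_ne_zero hx hz h0
    subst this
    exact h0 (hcon z hz)
  by_contra hlt
  obtain ⟨v, hv⟩ := (finrank_le_one_iff (K := ℂ) (V := weightSpace f χ)).1 (by omega)
  obtain ⟨a, ha⟩ := hv ⟨x, hx⟩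
  obtain ⟨b, hb⟩ := hv ⟨y, hy⟩
  have ha' : a • (v : l ⊕ l → ℂ) = x := congrArg Subtype.val ha
  have hb' : b • (v : l ⊕ l → ℂ) = y := congrArg Subtype.val hb
  apply hxy
  rw [← ha', ← hb', form_smul_left, form_smul_right, form_self, mul_zero, mul_zero]

/-- The weights that occur. -/
abbrev Weight (f : ι → Module.End ℂ (l ⊕ l → ℂ)) := {χ : ι → ℂ // weightSpace f χ ≠ ⊥}

theorem finite_weight : Finite (Weight f) :=
  WellFoundedGT.finite_ne_bot_of_iSupIndep hf.iSupIndep_weightSpace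

theorem sum_finrank [Fintype (Weight f)] :
    ∑ χ : Weight f, Module.finrank ℂ (weightSpace f χ.1) = 2 * Fintype.card l := by
  classical
  have h : DirectSum.IsInternal (fun χ : Weight f => weightSpace f χ.1) :=
    DirectSum.isInternal_ne_bot_iff.2
      (DirectSum.isInternal_submodule_of_iSupIndep_of_iSup_eq_top hf.iSupIndep_weightSpace
        hf.iSup_weightSpace)
  have h1 := Module.finrank_eq_card_basis
    (h.collectedBasis fun χ => Module.finBasis ℂ (weightSpace f χ.1))
  rw [Module.finrank_fintype_fun_eq_card, Fintype.card_sum, Fintype.card_sigma] at h1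
  simp only [Fintype.card_fin] at h1
  rw [← h1, two_mul]

/-- An involution of the family is determined by its signs on the occurring weights. -/
theorem card_le_two_pow [Fintype ι] [Fintype (Weight f)] (hinj : Function.Injective f) :
    Fintype.card ι ≤ 2 ^ Fintype.card (Weight f) := by
  classical
  have h : Function.Injective (fun (i : ι) (χ : Weight f) => decide (χ.1 i = 1)) := by
    intro i j hij
    refine hinj (LinearMap.ext fun x => ?_)
    refine hf.le_of_forall_weightSpace (S := LinearMap.eqLocus (f i) (f j)) (fun χ y hy => ?_) x
    by_cases hy0 : y = 0
    · rw [hy0]; exact Submodule.zero_mem _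
    have hχ : weightSpace f χ ≠ ⊥ := fun h => hy0 (by rwa [h, Submodule.mem_bot] at hy)
    have h1 := congrFun hij ⟨χ, hχ⟩
    have h2 : χ i = χ j := by
      have h3 : (χ i = 1) ↔ (χ j = 1) := by simpa using h1
      rcases mul_self_eq_one_iff.1 (hf.weight_mul_self hy hy0 i) with h4 | h4 <;>
        rcases mul_self_eq_one_iff.1 (hf.weight_mul_self hy hy0 j) with h5 | h5
      · rw [h4, h5]
      · rw [h4, h3.1 h4]
      · rw [h5, h3.2 h5]
      · rw [h4, h5]
    change f i y = f j y
    rw [mem_weightSpace.1 hy i, mem_weightSpace.1 hy j, h2]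
  have := Fintype.card_le_of_injective _ h
  simpa using this

/-- With `n` the rank, distinguishing `2^n` involutions needs at least `n` weights, while dimension
`2n` leaves room for at most `n` spaces of dimension at least two. -/
theorem card_weight [Fintype ι] [Fintype (Weight f)] (hinj : Function.Injective f)
    (hcard : Fintype.card ι = 2 ^ Fintype.card l) :
    Fintype.card (Weight f) = Fintype.card l ∧
      ∀ χ : Weight f, Module.finrank ℂ (weightSpace f χ.1) = 2 := by
  have h1 := hf.card_le_two_pow hinj
  rw [hcard] at h1
  have h2 : Fintype.card l ≤ Fintype.card (Weight f) := (Nat.pow_le_pow_iff_right (by norm_num)).1 h1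
  have h3 := hf.sum_finrank
  have h4 : ∑ χ : Weight f, 2 ≤ ∑ χ : Weight f, Module.finrank ℂ (weightSpace f χ.1) :=
    Finset.sum_le_sum fun χ _ => hf.two_le_finrank χ.2
  have h5 : ∑ χ : Weight f, 2 = 2 * Fintype.card (Weight f) := by simp [mul_comm]
  have h6 : Fintype.card (Weight f) = Fintype.card l := by omega
  refine ⟨h6, fun χ => ?_⟩
  have h7 : ∑ χ : Weight f, 2 = ∑ χ : Weight f, Module.finrank ℂ (weightSpace f χ.1) := by omega
  exact ((Finset.sum_eq_sum_iff_of_le fun χ _ => hf.two_le_finrank χ.2).1 h7 χ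
    (Finset.mem_univ _)).symm

end IsInvolutionFamily

end Weights

/-! ### Linear algebra on planes -/

section Centralizer

variable {K V : Type*} [Field K] [AddCommGroup V] [Module K V]

theorem exists_combination_of_finrank_two {W : Submodule K V} (hW : Module.finrank K W = 2)
    {x y : V} (hx : x ∈ W) (hy : y ∈ W) (hx0 : x ≠ 0) (hxy : ∀ c : K, y ≠ c • x) {z : V}
    (hz : z ∈ W) : ∃ a b : K, z = a • x + b • y := by
  have : Module.Finite K W := Module.finite_of_finrank_pos (by omega)
  have hli : LinearIndependent K ![(⟨x, hx⟩ : W), ⟨y, hy⟩] := by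
    rw [LinearIndependent.pair_iff' (fun h => hx0 (congrArg Subtype.val h))]
    intro a h
    exact hxy a (congrArg Subtype.val h).symm
  have hspan := hli.span_eq_top_of_card_eq_finrank (by simp [hW])
  have hz' : (⟨z, hz⟩ : W) ∈ Submodule.span K (Set.range ![(⟨x, hx⟩ : W), ⟨y, hy⟩]) := by
    rw [hspan]; exact Submodule.mem_top
  rw [Matrix.range_cons, Matrix.range_cons, Matrix.range_empty, Set.union_empty,
    Set.singleton_union, Submodule.mem_span_pair] at hz'
  obtain ⟨a, b, hab⟩ := hz'
  exact ⟨a, b, (congrArg Subtype.val hab).symm⟩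

/-- On a plane, the centralizer of a nonscalar endomorphism is commutative. -/
theorem apply_eq_smul_of_not_commute {W : Submodule K V} (hW : Module.finrank K W = 2)
    {A B C : Module.End K V} (hA : ∀ x ∈ W, A x ∈ W) (hB : ∀ x ∈ W, B x ∈ W)
    (hC : ∀ x ∈ W, C x ∈ W) (hAC : Commute A C) (hBC : Commute B C)
    (h : ∃ x ∈ W, A (B x) ≠ B (A x)) {x : V} (hx : x ∈ W) : ∃ c : K, C x = c • x := by
  -- If `x` and `C x` are independent, `A` and `B` are determined on the plane by their values at
  -- `x`, hence agree there with polynomials in `C` and commute.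
  by_contra hcon
  push Not at hcon
  have hx0 : x ≠ 0 := by rintro rfl; exact hcon 0 (by simp)
  have cA : ∀ y, A (C y) = C (A y) := fun y => LinearMap.congr_fun hAC.eq y
  have cB : ∀ y, B (C y) = C (B y) := fun y => LinearMap.congr_fun hBC.eq y
  have comb := fun {z} => exists_combination_of_finrank_two hW hx (hC x hx) hx0 hcon (z := z)
  obtain ⟨a, b, hAx⟩ := comb (hA x hx)
  obtain ⟨a', b', hBx⟩ := comb (hB x hx)
  have key : A (B x) = B (A x) := by
    rw [hAx, hBx]
    simp only [map_add, map_smul, cA, cB, hAx, hBx]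
    module
  obtain ⟨y, hy, hne⟩ := h
  obtain ⟨p, q, rfl⟩ := comb hy
  apply hne
  simp only [map_add, map_smul, cA, cB, key]

theorem exists_ne_zero_apply_eq_zero {W : Submodule K V} (hW : W ≠ ⊥) {A : Module.End K V}
    (hA : ∀ x ∈ W, A x ∈ W) (hnil : IsNilpotent A) : ∃ z ∈ W, z ≠ 0 ∧ A z = 0 := by
  obtain ⟨k, hk⟩ := hnil
  obtain ⟨x, hx, hx0⟩ := Submodule.exists_mem_ne_zero_of_ne_bot hW
  by_contra hcon
  push Not at hcon
  have : ∀ m : ℕ, (A ^ m) x ∈ W ∧ (A ^ m) x ≠ 0 := by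
    intro m
    induction m with
    | zero => exact ⟨hx, hx0⟩
    | succ m ih =>
      rw [pow_succ', Module.End.mul_apply]
      exact ⟨hA _ ih.1, fun h => hcon _ ih.1 ih.2 h⟩
  exact (this k).2 (by rw [hk]; rfl)

/-- A nilpotent map kills a line of the plane, so one complementary vector determines its image. -/
theorem exists_range_of_nilpotent {W : Submodule K V} (hW : Module.finrank K W = 2)
    {A : Module.End K V} (hA : ∀ x ∈ W, A x ∈ W) (hnil : IsNilpotent A) :
    ∃ u, ∀ x ∈ W, ∃ c : K, A x = c • u := by
  have hbot : W ≠ ⊥ := by rintro rfl; simp at hW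
  obtain ⟨z, hz, hz0, hAz⟩ := exists_ne_zero_apply_eq_zero hbot hA hnil
  obtain ⟨y, hy, hyz⟩ : ∃ y ∈ W, ∀ c : K, y ≠ c • z := by
    by_contra hcon
    push Not at hcon
    have : Module.finrank K W ≤ 1 := finrank_le_one ⟨z, hz⟩ fun w => by
      obtain ⟨c, hc⟩ := hcon w w.2
      exact ⟨c, Subtype.ext hc.symm⟩
    omega
  refine ⟨A y, fun x hx => ?_⟩
  obtain ⟨a, b, rfl⟩ := exists_combination_of_finrank_two hW hz hy hz0 hyz hx
  exact ⟨b, by rw [map_add, map_smul, map_smul, hAz, smul_zero, zero_add]⟩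

end Centralizer

/-! ### One plane for each commuting pair -/

section RankOneRange

variable {l ι : Type*} [Fintype l] [DecidableEq l] [Fintype ι]
  {f : ι → Module.End ℂ (l ⊕ l → ℂ)}

/-- Nilpotent endomorphisms `A i` with commuting partners, all centralizing a large group of
involutions, have range of dimension at most one. -/
theorem exists_range_le_span (hf : IsInvolutionFamily f) (hinj : Function.Injective f)
    (hcard : Fintype.card ι = 2 ^ Fintype.card l) {A B : l → Module.End ℂ (l ⊕ l → ℂ)}
    (hAf : ∀ i j, Commute (A i) (f j)) (hBf : ∀ i j, Commute (B i) (f j))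
    (hAA : ∀ i j, i ≠ j → Commute (A i) (A j)) (hAB : ∀ i j, i ≠ j → Commute (A i) (B j))
    (hne : ∀ i, A i * B i ≠ B i * A i) (hnil : ∀ i, IsNilpotent (A i)) (i : l) :
    ∃ u, ∀ x, ∃ c : ℂ, A i x = c • u := by
  classical
  have := hf.finite_weight
  have := Fintype.ofFinite (IsInvolutionFamily.Weight f)
  obtain ⟨hcw, hrank⟩ := hf.card_weight hinj hcard
  have hmaps : ∀ {C : Module.End ℂ (l ⊕ l → ℂ)}, (∀ j, Commute C (f j)) → ∀ χ,
      ∀ x ∈ weightSpace f χ, C x ∈ weightSpace f χ := by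
    intro C hC χ x hx
    rw [mem_weightSpace] at hx ⊢
    intro j
    rw [← Module.End.mul_apply, ← (hC j).eq, Module.End.mul_apply, hx, map_smul]
  have hex : ∀ i, ∃ χ : IsInvolutionFamily.Weight f, ∃ x ∈ weightSpace f χ.1,
      A i (B i x) ≠ B i (A i x) := by
    intro i
    by_contra hcon
    push Not at hcon
    refine hne i (LinearMap.ext fun x => ?_)
    refine hf.le_of_forall_weightSpace (S := LinearMap.eqLocus (A i * B i) (B i * A i))
      (fun χ y hy => ?_) x
    by_cases hχ : weightSpace f χ = ⊥
    · rw [hχ, Submodule.mem_bot] at hy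
      rw [hy]; exact Submodule.zero_mem _
    · exact hcon ⟨χ, hχ⟩ y hy
  choose J hJ using hex
  -- On the plane where `A j` and `B j` do not commute, `A i` centralizes both, so it is scalar;
  -- being nilpotent, it vanishes.
  have hzero : ∀ i j, i ≠ j → ∀ x ∈ weightSpace f (J j).1, A i x = 0 := by
    intro i j hij x hx
    obtain ⟨c, hc⟩ := apply_eq_smul_of_not_commute (hrank (J j)) (hmaps (hAf j) _)
      (hmaps (hBf j) _) (hmaps (hAf i) _) (hAA j i hij.symm) (hAB i j hij).symm (hJ j) hx
    obtain ⟨k, hk⟩ := hnil i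
    have hpow : ∀ m : ℕ, (A i ^ m) x = c ^ m • x := by
      intro m
      induction m with
      | zero => simp
      | succ m ih => rw [pow_succ', Module.End.mul_apply, ih, map_smul, hc, smul_smul, pow_succ]
    have h1 := hpow k
    rw [hk, LinearMap.zero_apply, eq_comm, smul_eq_zero] at h1
    rcases h1 with h1 | h1
    · rw [hc, eq_zero_of_pow_eq_zero h1, zero_smul]
    · rw [h1, map_zero]
  have hJinj : Function.Injective J := by
    intro i j hij
    by_contra hne'
    obtain ⟨x, hx, hxne⟩ := hJ j
    have hx' := hij ▸ hJ i
    obtain ⟨y, hy, hyne⟩ := hx'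
    apply hyne
    rw [hzero i j hne' y hy, map_zero, hzero i j hne' _ (hmaps (hBf i) _ y hy)]
  -- There are as many planes as indices, so each plane belongs to some index and `A i` lives on a
  -- single one.
  have hJsurj : Function.Surjective J :=
    ((Fintype.bijective_iff_injective_and_card J).2 ⟨hJinj, hcw.symm⟩).2
  obtain ⟨u, hu⟩ := exists_range_of_nilpotent (hrank (J i)) (hmaps (hAf i) _) (hnil i)
  refine ⟨u, fun x => ?_⟩
  have hx : x ∈ (Submodule.span ℂ {u}).comap (A i) := by
    refine hf.le_of_forall_weightSpace (fun χ y hy => ?_) x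
    rw [Submodule.mem_comap, Submodule.mem_span_singleton]
    by_cases hχ : weightSpace f χ = ⊥
    · rw [hχ, Submodule.mem_bot] at hy
      exact ⟨0, by rw [hy, map_zero, zero_smul]⟩
    · obtain ⟨j, hj⟩ := hJsurj ⟨χ, hχ⟩
      have hχj : χ = (J j).1 := by rw [hj]
      by_cases hij : i = j
      · subst hij
        obtain ⟨c, hc⟩ := hu y (hχj ▸ hy)
        exact ⟨c, hc.symm⟩
      · exact ⟨0, by rw [hzero i j hij y (hχj ▸ hy), zero_smul]⟩
  rw [Submodule.mem_comap, Submodule.mem_span_singleton] at hx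
  obtain ⟨c, hc⟩ := hx
  exact ⟨c, hc.symm⟩

end RankOneRange

/-! ### Rank at least two: images of transvections -/

section ComplexRepresentation

variable {l : Type*} [Fintype l] [DecidableEq l]

/-- The action on `ℂ`-vectors obtained by precomposing the standard one with an automorphism. -/
noncomputable def complexRep (φ : MulAut (symplecticGroup l ℤ)) :
    symplecticGroup l ℤ →* Module.End ℂ (l ⊕ l → ℂ) where
  toFun g := toLin' ((Int.castRingHom ℂ).mapMatrix (φ g).1)
  map_one' := by
    rw [map_one, OneMemClass.coe_one, map_one, toLin'_one]
    rfl
  map_mul' g h := by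
    rw [map_mul, MulMemClass.coe_mul, map_mul, toLin'_mul]
    rfl

theorem complexRep_apply (φ : MulAut (symplecticGroup l ℤ)) (g : symplecticGroup l ℤ)
    (x : l ⊕ l → ℂ) : complexRep φ g x = (φ g).1.map (Int.cast : ℤ → ℂ) *ᵥ x := rfl

theorem complexRep_intCast (φ : MulAut (symplecticGroup l ℤ)) (g : symplecticGroup l ℤ)
    (x : l ⊕ l → ℤ) (p : l ⊕ l) :
    complexRep φ g (fun q => (x q : ℂ)) p = (((φ g).1 *ᵥ x) p : ℤ) := by
  simp [complexRep_apply, mulVec, dotProduct]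

theorem complexRep_injective (φ : MulAut (symplecticGroup l ℤ)) :
    Function.Injective (complexRep φ) := fun _ _ hgh =>
  φ.injective <| Subtype.ext <|
    Matrix.map_injective (Int.castRingHom ℂ).injective_int (toLin'.injective hgh)

theorem form_complexRep (φ : MulAut (symplecticGroup l ℤ)) (g : symplecticGroup l ℤ)
    (x y : l ⊕ l → ℂ) : form (complexRep φ g x) (complexRep φ g y) = form x y := by
  have h : (φ g).1.map (Int.cast : ℤ → ℂ) ∈ symplecticGroup l ℂ :=
    SymplecticGroup.map_mem (φ g).2 (Int.castRingHom ℂ)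
  rw [complexRep_apply, complexRep_apply]
  exact mem_iff_form.1 h x y

/-- The diagonal symplectic matrix with sign `σ i` on the `i`-th hyperbolic plane. -/
def signDiagonal (σ : l → ℤˣ) : symplecticGroup l ℤ :=
  ⟨diagonal fun p => (σ (p.elim id id) : ℤ), mem_iff_form.2 fun x y => by
    have h : ∀ i, (σ i : ℤ) * σ i = 1 := fun i => by
      rw [← Units.val_mul, Int.units_mul_self, Units.val_one]
    simp only [form_eq_sum, mulVec_diagonal, Sum.elim_inl, Sum.elim_inr, id]
    refine Finset.sum_congr rfl fun i _ => ?_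
    linear_combination (x (.inr i) * y (.inl i) - x (.inl i) * y (.inr i)) * h i⟩

theorem signDiagonal_mulVec (σ : l → ℤˣ) (x : l ⊕ l → ℤ) (p : l ⊕ l) :
    ((signDiagonal σ).1 *ᵥ x) p = σ (p.elim id id) * x p :=
  mulVec_diagonal _ _ _

theorem signDiagonal_mul (σ τ : l → ℤˣ) :
    signDiagonal σ * signDiagonal τ = signDiagonal (σ * τ) :=
  group_ext fun x => by
    ext p
    rw [mul_mulVec]
    simp [signDiagonal_mulVec, mul_assoc]

theorem signDiagonal_one : signDiagonal (1 : l → ℤˣ) = 1 :=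
  group_ext fun x => by
    ext p
    simp [signDiagonal_mulVec]

theorem signDiagonal_injective : Function.Injective (signDiagonal (l := l)) := by
  intro σ τ h
  ext i
  have := congrArg (fun g : symplecticGroup l ℤ => (g.1 *ᵥ E ℤ (.inl i)) (.inl i)) h
  simpa [signDiagonal_mulVec, E] using this

theorem commute_signDiagonal_T (σ : l → ℤˣ) (c : ℤ) (p : l ⊕ l) :
    Commute (signDiagonal σ) (T c (E ℤ p)) := by
  rw [Commute, SemiconjBy, mul_T]
  congr 1
  have h : (signDiagonal σ).1 *ᵥ E ℤ p = (σ (p.elim id id) : ℤ) • E ℤ p := by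
    ext q
    rw [signDiagonal_mulVec, Pi.smul_apply, smul_eq_mul]
    by_cases hq : q = p
    · rw [hq]
    · simp [E, hq]
  rw [h]
  rcases Int.units_eq_one_or (σ (p.elim id id)) with h1 | h1 <;> simp [h1, T_neg]

theorem isInvolutionFamily_signDiagonal (φ : MulAut (symplecticGroup l ℤ)) :
    IsInvolutionFamily fun σ => complexRep φ (signDiagonal σ) where
  sq σ x := by
    rw [← Module.End.mul_apply, ← map_mul, signDiagonal_mul,
      show σ * σ = 1 from funext fun i => Int.units_mul_self _, signDiagonal_one, map_one,
      Module.End.one_apply]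
  comm σ τ := by
    rw [Commute, SemiconjBy, ← map_mul, ← map_mul, signDiagonal_mul, signDiagonal_mul, mul_comm]
  form_apply σ := form_complexRep φ _

/-- In rank at least two an automorphism maps some power of a transvection to a transvection. -/
theorem exists_map_T_eq (φ : MulAut (symplecticGroup l ℤ)) {i j : l} (hij : i ≠ j) :
    ∃ (k c : ℤ) (w : l ⊕ l → ℤ), k ≠ 0 ∧ c ≠ 0 ∧ Primitive w ∧
      φ (T k (E ℤ (.inl i))) = T c w := by
  obtain ⟨k, hk, hnil⟩ := exists_isNilpotent (complexRep φ) hij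
  have hk0 : (k : ℤ) ≠ 0 := by exact_mod_cast hk.ne'
  have hcomm : ∀ {g h : symplecticGroup l ℤ}, Commute g h →
      Commute (complexRep φ g - 1) (complexRep φ h - 1) := fun h =>
    (((h.map (complexRep φ)).sub_left (Commute.one_left _))).sub_right (Commute.one_right _)
  obtain ⟨u, hu⟩ := exists_range_le_span (isInvolutionFamily_signDiagonal φ)
    ((complexRep_injective φ).comp signDiagonal_injective) (by simp)
    (A := fun i => complexRep φ (T k (E ℤ (.inl i))) - 1)
    (B := fun i => complexRep φ (T k (E ℤ (.inr i))) - 1)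
    (fun i σ => (((commute_signDiagonal_T σ k _).symm.map (complexRep φ)).sub_left
      (Commute.one_left _)))
    (fun i σ => (((commute_signDiagonal_T σ k _).symm.map (complexRep φ)).sub_left
      (Commute.one_left _)))
    (fun i j _ => hcomm (commute_T (by simp [form_E_E]) _ _))
    (fun i j h => hcomm (commute_T (by simp [form_E_E, h.symm]) _ _))
    (fun i h => by
      have h1 : Commute (complexRep φ (T k (E ℤ (.inl i)))) (complexRep φ (T k (E ℤ (.inr i)))) := by
        have h2 : Commute (complexRep φ (T k (E ℤ (.inl i))) - 1)
          (complexRep φ (T k (E ℤ (.inr i))) - 1) := h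
        simpa using (h2.add_left (Commute.one_left _)).add_right (Commute.one_right _)
      have h2 : Commute (T (k : ℤ) (E ℤ (.inl i : l ⊕ l))) (T (k : ℤ) (E ℤ (.inr i))) :=
        complexRep_injective φ (by rw [map_mul, map_mul, h1.eq])
      have h3 := form_eq_zero_of_commute hk0 hk0 h2
      simp [form_E_E, sgn] at h3)
    (fun i => hnil _ (primitive_E _)) i
  set g := φ (T (k : ℤ) (E ℤ (.inl i))) with hg
  have hg1 : g ≠ 1 := by
    rw [hg, Ne, map_eq_one_iff φ φ.injective]
    intro h
    have h1 : form (E ℤ (.inl i : l ⊕ l)) (E ℤ (.inr i)) = 0 :=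
      form_eq_zero_of_commute hk0 hk0 (h ▸ Commute.one_left _)
    simp [form_E_E, sgn] at h1
  -- The rank bound over `ℂ` descends to the integers as the vanishing of two-by-two minors.
  have hminor : ∀ (x y : l ⊕ l → ℤ) (p q : l ⊕ l),
      (g.1 *ᵥ x - x) p * (g.1 *ᵥ y - y) q = (g.1 *ᵥ x - x) q * (g.1 *ᵥ y - y) p := by
    have key : ∀ x : l ⊕ l → ℤ, ∃ c : ℂ, ∀ p, (((g.1 *ᵥ x - x) p : ℤ) : ℂ) = c * u p := by
      intro x
      obtain ⟨c, hc⟩ := hu fun q => (x q : ℂ)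
      refine ⟨c, fun p => ?_⟩
      have := congrFun hc p
      rw [LinearMap.sub_apply, Module.End.one_apply, Pi.sub_apply, complexRep_intCast] at this
      rw [Pi.sub_apply, Int.cast_sub, hg, this, Pi.smul_apply, smul_eq_mul]
    intro x y p q
    obtain ⟨a, ha⟩ := key x
    obtain ⟨b, hb⟩ := key y
    have : (((g.1 *ᵥ x - x) p : ℤ) : ℂ) * ((g.1 *ᵥ y - y) q : ℤ) =
        ((g.1 *ᵥ x - x) q : ℤ) * ((g.1 *ᵥ y - y) p : ℤ) := by
      rw [ha, ha, hb, hb]; ring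
    exact_mod_cast this
  obtain ⟨y, q, hyq⟩ : ∃ y q, (g.1 *ᵥ y - y) q ≠ 0 := by
    by_contra hcon
    push Not at hcon
    refine hg1 (group_ext fun x => ?_)
    rw [one_mulVec']
    exact sub_eq_zero.1 (funext (hcon x))
  obtain ⟨c, w, hc, hw, hgw⟩ := exists_eq_T hg1 (u := g.1 *ᵥ y - y) fun x =>
    ⟨_, (g.1 *ᵥ x - x) q, hyq, funext fun p => by
      rw [Pi.smul_apply, Pi.smul_apply, smul_eq_mul, smul_eq_mul, hminor x y q p, mul_comm]⟩
  exact ⟨k, c, w, hk0, hc, hw, hgw⟩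

theorem reidemeisterNumber_eq_top (φ : MulAut (symplecticGroup l ℤ)) {i j : l} (hij : i ≠ j) :
    reidemeisterNumber φ = ⊤ := by
  obtain ⟨k, c, w, hk, hc, hw, h⟩ := exists_map_T_eq φ hij
  exact reidemeisterNumber_eq_top_of_map_T (primitive_E _) hw hk hc h i

end ComplexRepresentation

end Symplectic

theorem theorem3p3 (n : ℕ) (hn : 1 ≤ n) (φ : MulAut (Matrix.symplecticGroup (Fin n) ℤ)) :
    reidemeisterNumber φ = ⊤ := by
  -- Rank one needs separate treatment: the representation argument uses two different hyperbolic
  -- planes.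
  obtain rfl | h := hn.eq_or_lt'
  · exact Symplectic.reidemeisterNumber_plane φ
  · exact Symplectic.reidemeisterNumber_eq_top φ (i := ⟨0, by omega⟩) (j := ⟨1, h⟩) (by simp)
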